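/- Consider the AKLT Hamiltonian $H=\sum_{j}\mathbf S_j\cdot\mathbf S_{j+1}+\tfrac13(\mathbf S_j\cdot\mathbf S_{j+1})^2$ on a ring of $N$ spins one (indices modulo $N$). The AKLT state $|\psi\rangle$ is obtained by placing two virtual qubits at each site, putting the right qubit of each site and the left qubit of the next site in the singlet $|\psi^-\rangle=(|01\rangle-|10\rangle)/\sqrt2$, projecting the two qubits of each site onto the triplet space with basis $|\tilde0\rangle=|00\rangle$, $|\tilde1\rangle=|11\rangle$, $|\tilde2\rangle=(|01\rangle+|10\rangle)/\sqrt2$, and normalizing. (1) For $N\ge3$, $|\psi\rangle$ is a ground state of $H$, and measuring any site in the basis $\{|\tilde0\rangle,|\tilde1\rangle,|\tilde2\rangle\}$ gives each outcome with probability $1/3$. (2) Let $n\ge1$ and $N\ge 2n+2$. Measure the $n$ sites on each side of a pair $(j,j+1)$ in this basis; this gives $3^{2n}$ branches. Say that the pair is cut out if an outcome other than $\tilde2$ occurs on both sides. The probability of this satisfies $$1-2\left(\tfrac13\right)^n\le p_{\rm cut}\le 1-2\left(\tfrac13\right)^n+2\left(\tfrac19\right)^n .$$ In every branch of non-zero probability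 in which the pair is cut out, the pair is left in a pure entangled state, namely, for some $i,k\in\{0,1\}$, in the normalization of $P_AP_B\,|i\rangle_A(|0\rangle_A|1\rangle_B-|1\rangle_A|0\rangle_B)|k\rangle_B$, where $P_A,P_B$ are the projectors onto the triplet spaces of the two sites. (3) A Bell expression for the scheme is a sum, over all pairs $(j,j+1)$ of the ring and all $3^{2n}$ branches of the cutting measurement of each pair, of bipartite Bell expressions with two settings and two outcomes per party for the two parties of the pair. Say that the scheme detects genuine multipartite entanglement if some such expression takes on $|\psi\rangle$, with the cutting measurements in the above basis and suitable Bell measurements, a value strictly above an upper bound that holds for all biseparable states (mixtures of states $\rho_{g}\otimes\rho_{g^c}$ with $g$ a non-empty proper subset of the parties, where $g$ may vary within the mixture) of arbitrary finite local dimensions and for arbitrary local measurements. There are constants $0\le\beta_L<\beta_*$, independent of $N$ and $n$, such that for all $n\ge1$ and $N\ge2n+2$ there are such an expression and such measurements for which the part belonging to each pair is at most $\beta_*$ on every quantum state with any measurements and at least $\beta_*\left(1-4\cdot3^{-n}\right)$ on $|\psi\rangle$, while the whole expression is at most $(N-1)\beta_*+\beta_L$ on biseparable states with any measurements. Moreover,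 the scheme detects genuine multipartite entanglement whenever $N\le\tfrac14\,3^{n}\,(1-\beta_L/\beta_*)$. (4) In particular, for all sufficiently large $N$ and $n=\lceil2\log_3N\rceil$ one has $2n+2\le N$, each pair is cut out with probability at least $1-2/N^2$, the scheme detects the genuine $N$-partite entanglement of $|\psi\rangle$, and the number $3^{2n}$ of branches per pair is polynomial in $N$: $N^4\le3^{2n}\le9N^4$. -/

import Mathlib

open scoped ComplexOrder

/-! ### Local operators, density matrices, measurements

Sites and parties are the elements of `ZMod N` (a ring of `N` sites).  Party `i` holds the
Hilbert space `ℂ ^ (d i)`; the joint Hilbert space has the basis `(i : ZMod N) → Fin (d i)`. -/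

/-- The tensor product `⨂ i, E i` of local operators, as a matrix on the joint space. -/
def tensorOp {N : ℕ} [NeZero N] {d : ZMod N → ℕ}
    (E : (i : ZMod N) → Matrix (Fin (d i)) (Fin (d i)) ℂ) :
    Matrix ((i : ZMod N) → Fin (d i)) ((i : ZMod N) → Fin (d i)) ℂ :=
  Matrix.of fun s t => ∏ i, E i (s i) (t i)

/-- Density matrices. -/
def IsDensity {κ : Type*} [Fintype κ] (ρ : Matrix κ κ ℂ) : Prop :=
  ρ.PosSemidef ∧ ρ.trace = 1

/-- Measurements with outcomes in `ω` (positive operator valued measures). -/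
def IsPOVM {κ ω : Type*} [Fintype κ] [DecidableEq κ] [Fintype ω]
    (E : ω → Matrix κ κ ℂ) : Prop :=
  (∀ o, (E o).PosSemidef) ∧ ∑ o, E o = 1

/-- `ρ = ρ₁ ⊗ ρ₂` with `ρ₁` a state of the parties in `g` and `ρ₂` a state of the others. -/
def IsProductAcross {N : ℕ} [NeZero N] {d : ZMod N → ℕ} (g : Finset (ZMod N))
    (ρ : Matrix ((i : ZMod N) → Fin (d i)) ((i : ZMod N) → Fin (d i)) ℂ) : Prop :=
  ∃ (ρ₁ : Matrix ((i : {i // i ∈ g}) → Fin (d i)) ((i : {i // i ∈ g}) → Fin (d i)) ℂ)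
    (ρ₂ : Matrix ((i : {i // i ∉ g}) → Fin (d i)) ((i : {i // i ∉ g}) → Fin (d i)) ℂ),
    IsDensity ρ₁ ∧ IsDensity ρ₂ ∧
      ∀ s t, ρ s t = ρ₁ (fun i => s i) (fun i => t i) * ρ₂ (fun i => s i) (fun i => t i)

/-- Biseparable states: mixtures of states that are products across some splitting of the
parties into two non-empty groups (the splitting may vary within the mixture). -/
def IsBiseparable {N : ℕ} [NeZero N] {d : ZMod N → ℕ}
    (ρ : Matrix ((i : ZMod N) → Fin (d i)) ((i : ZMod N) → Fin (d i)) ℂ) : Prop :=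
  ρ ∈ convexHull ℝ {σ | ∃ g : Finset (ZMod N), g.Nonempty ∧ gᶜ.Nonempty ∧ IsProductAcross g σ}

/-! ### The AKLT model on a ring -/

/-- The basis `|0̃⟩ = |00⟩`, `|1̃⟩ = |11⟩`, `|2̃⟩ = (|01⟩ + |10⟩)/√2` of the triplet space of the
two virtual qubits of a site: `tripletBasis s l r = ⟨l r | s̃⟩`. -/
noncomputable def tripletBasis : Fin 3 → Matrix (Fin 2) (Fin 2) ℂ :=
  ![!![1, 0; 0, 0], !![0, 0; 0, 1],
    !![0, ((√2)⁻¹ : ℝ); ((√2)⁻¹ : ℝ), 0]]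

/-- The singlet `(|01⟩ - |10⟩)/√2` of two virtual qubits. -/
noncomputable def singlet : Matrix (Fin 2) (Fin 2) ℂ :=
  !![0, ((√2)⁻¹ : ℝ); -((√2)⁻¹ : ℝ), 0]

/-- `v / ‖v‖`. -/
noncomputable def unitVec {κ : Type*} [Fintype κ] (v : EuclideanSpace ℂ κ) :
    EuclideanSpace ℂ κ :=
  ((‖v‖⁻¹ : ℝ) : ℂ) • v

/-- The AKLT state of `N` spins one on a ring, in the basis `|0̃⟩, |1̃⟩, |2̃⟩` of each site: the
right virtual qubit of each site and the left virtual qubit of the next site form a singlet, the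
two virtual qubits of each site are projected onto the triplet space, and the result is
normalized. -/
noncomputable def akltState (N : ℕ) [NeZero N] : EuclideanSpace ℂ (ZMod N → Fin 3) :=
  unitVec <| WithLp.toLp 2 fun s =>
    ∑ l : ZMod N → Fin 2, ∑ r : ZMod N → Fin 2,
      (∏ i, star (tripletBasis (s i) (l i) (r i))) * ∏ i, singlet (r i) (l (i + 1))

/-- The spin-one matrices `Sˣ, Sʸ, Sᶻ` in the basis `|0̃⟩, |1̃⟩, |2̃⟩`, whose members have
`Sᶻ = 1, -1, 0`. -/
noncomputable def spinOne : Fin 3 → Matrix (Fin 3) (Fin 3) ℂ :=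
  ![((√2)⁻¹ : ℂ) • !![0, 0, 1; 0, 0, 1; 1, 1, 0],
    ((√2)⁻¹ : ℂ) • !![0, 0, -Complex.I; 0, 0, Complex.I; Complex.I, -Complex.I, 0],
    !![1, 0, 0; 0, -1, 0; 0, 0, 0]]

/-- The operator `A` of one spin, acting on site `i`. -/
def siteOp {N : ℕ} [NeZero N] (i : ZMod N) (A : Matrix (Fin 3) (Fin 3) ℂ) :
    Matrix (ZMod N → Fin 3) (ZMod N → Fin 3) ℂ :=
  tensorOp (d := fun _ => 3) fun k => if k = i then A else 1

/-- The Heisenberg coupling `𝐒_j · 𝐒_{j+1}`. -/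
noncomputable def spinDot {N : ℕ} [NeZero N] (j : ZMod N) :
    Matrix (ZMod N → Fin 3) (ZMod N → Fin 3) ℂ :=
  ∑ α, siteOp j (spinOne α) * siteOp (j + 1) (spinOne α)

/-- The AKLT Hamiltonian `∑ j, 𝐒_j · 𝐒_{j+1} + (1/3) (𝐒_j · 𝐒_{j+1})²`. -/
noncomputable def akltHamiltonian (N : ℕ) [NeZero N] :
    Matrix (ZMod N → Fin 3) (ZMod N → Fin 3) ℂ :=
  ∑ j, (spinDot j + (1 / 3 : ℂ) • (spinDot j * spinDot j))

/-- `⟨ψ|H|ψ⟩`. -/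
noncomputable def energy {κ : Type*} [Fintype κ] (H : Matrix κ κ ℂ) (ψ : EuclideanSpace ℂ κ) : ℝ :=
  (star (ψ : κ → ℂ) ⬝ᵥ H.mulVec ψ).re

/-- Unit vectors of minimal energy. -/
def IsGroundState {κ : Type*} [Fintype κ] (H : Matrix κ κ ℂ) (ψ : EuclideanSpace ℂ κ) : Prop :=
  ‖ψ‖ = 1 ∧ ∀ φ : EuclideanSpace ℂ κ, ‖φ‖ = 1 → energy H ψ ≤ energy H φ

/-! ### Cutting out the pair `(j, j + 1)` -/

/-- The `n` sites `j - 1, …, j - n`. -/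
def leftBlock {N : ℕ} (j : ZMod N) (n : ℕ) : Finset (ZMod N) :=
  (Finset.range n).image fun k : ℕ => j - 1 - (k : ZMod N)

/-- The `n` sites `j + 2, …, j + 1 + n`. -/
def rightBlock {N : ℕ} (j : ZMod N) (n : ℕ) : Finset (ZMod N) :=
  (Finset.range n).image fun k : ℕ => j + 2 + (k : ZMod N)

/-- The branches of the cutting protocol: one outcome `0̃`, `1̃` or `2̃` for each measured site. -/
abbrev Branch {N : ℕ} (j : ZMod N) (n : ℕ) : Type :=
  {i // i ∈ leftBlock j n ∪ rightBlock j n} → Fin 3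

/-- The pair is cut out: an outcome other than `2̃` has occurred on both sides. -/
def IsCut {N : ℕ} {j : ZMod N} {n : ℕ} (μ : Branch j n) : Prop :=
  (∃ i, i.1 ∈ leftBlock j n ∧ μ i ≠ 2) ∧ (∃ i, i.1 ∈ rightBlock j n ∧ μ i ≠ 2)

open Classical in
/-- The probability of the outcomes `μ`, by the Born rule. -/
noncomputable def branchProb {N : ℕ} [NeZero N] (ψ : EuclideanSpace ℂ (ZMod N → Fin 3))
    {j : ZMod N} {n : ℕ} (μ : Branch j n) : ℝ :=
  ∑ s : ZMod N → Fin 3, if ∀ i, s i.1 = μ i then ‖ψ s‖ ^ 2 else 0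

open Classical in
/-- The probability that the pair `(j, j + 1)` is cut out. -/
noncomputable def cutProb {N : ℕ} [NeZero N] (ψ : EuclideanSpace ℂ (ZMod N → Fin 3))
    (j : ZMod N) (n : ℕ) : ℝ :=
  ∑ μ : Branch j n, if IsCut μ then branchProb ψ μ else 0

open Classical in
/-- The state of the pair `(j, j + 1)` after the outcomes `μ`: the normalized post-measurement
state, with all other sites traced out. -/
noncomputable def pairState {N : ℕ} [NeZero N] (ψ : EuclideanSpace ℂ (ZMod N → Fin 3))
    {j : ZMod N} {n : ℕ} (μ : Branch j n) : Matrix (Fin 3 × Fin 3) (Fin 3 × Fin 3) ℂ :=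
  Matrix.of fun p q =>
    ((branchProb ψ μ)⁻¹ : ℝ) * ∑ s : ZMod N → Fin 3,
      if (∀ i, s i.1 = μ i) ∧ s j = p.1 ∧ s (j + 1) = p.2 then
        ψ s * star (ψ (Function.update (Function.update s j q.1) (j + 1) q.2))
      else 0

/-- The vector `P_A P_B |i⟩_A (|0⟩_A |1⟩_B - |1⟩_A |0⟩_B) |k⟩_B`, normalized, where `P_A`, `P_B`
project onto the triplet spaces of the two sites. -/
noncomputable def pairVec (i k : Fin 2) : EuclideanSpace ℂ (Fin 3 × Fin 3) :=
  unitVec <| WithLp.toLp 2 fun p =>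
    ∑ x, ∑ y, star (tripletBasis p.1 i x) * singlet x y * star (tripletBasis p.2 y k)

/-- A vector of two spins is entangled if it is not a product vector. -/
def IsEntangled (φ : EuclideanSpace ℂ (Fin 3 × Fin 3)) : Prop :=
  ¬ ∃ u v : Fin 3 → ℂ, ∀ a b, φ (a, b) = u a * v b

/-! ### Device-independent tests -/

/-- The devices of all parties.  Party `i` can perform a cutting measurement with three outcomes
and, for every pair `(j, j + 1)`, every branch `μ` and every `x`, a measurement with two outcomes
which serves as the setting `x` of the bipartite Bell test of that pair in that branch.  (Only the
Bell settings of the two pairs to which `i` belongs are ever used.) -/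
structure Devices (N n : ℕ) [NeZero N] (d : ZMod N → ℕ) where
  cut : (i : ZMod N) → Fin 3 → Matrix (Fin (d i)) (Fin (d i)) ℂ
  bell : (i j : ZMod N) → Branch j n → Fin 2 → Fin 2 → Matrix (Fin (d i)) (Fin (d i)) ℂ
  cut_povm : ∀ i, IsPOVM (cut i)
  bell_povm : ∀ i j μ x, IsPOVM (bell i j μ x)

/-- The coefficients of a bipartite Bell expression (settings `x, y`, outcomes `a, b`) for every
pair `(j, j + 1)` and every branch `μ`, as a function `c j μ x y a b`. -/
abbrev BellCoeff (N n : ℕ) : Type :=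
  (j : ZMod N) → Branch j n → Fin 2 → Fin 2 → Fin 2 → Fin 2 → ℝ

open Classical in
/-- The probability of the joint outcome: `μ` in the cutting measurements of the two blocks, `a` at
party `j` for its Bell setting `x`, `b` at party `j + 1` for its Bell setting `y`.  Nothing is
measured elsewhere. -/
noncomputable def jointProb {N n : ℕ} [NeZero N] {d : ZMod N → ℕ} (D : Devices N n d)
    (ρ : Matrix ((i : ZMod N) → Fin (d i)) ((i : ZMod N) → Fin (d i)) ℂ)
    (j : ZMod N) (μ : Branch j n) (x y a b : Fin 2) : ℝ :=
  (ρ * tensorOp fun i =>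
    if i = j then D.bell i j μ x a
    else if i = j + 1 then D.bell i j μ y b
    else if h : i ∈ leftBlock j n ∪ rightBlock j n then D.cut i (μ ⟨i, h⟩)
    else 1).trace.re

/-- The value of the Bell expression of the pair `(j, j + 1)`, summed over all branches. -/
noncomputable def pairValue {N n : ℕ} [NeZero N] {d : ZMod N → ℕ} (c : BellCoeff N n)
    (D : Devices N n d)
    (ρ : Matrix ((i : ZMod N) → Fin (d i)) ((i : ZMod N) → Fin (d i)) ℂ) (j : ZMod N) : ℝ :=
  ∑ μ : Branch j n, ∑ x, ∑ y, ∑ a, ∑ b, c j μ x y a b * jointProb D ρ j μ x y a b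

/-- The value of the multipartite Bell expression: the sum over the covering set of all pairs
`(j, j + 1)` of neighbours on the ring. -/
noncomputable def bellValue {N n : ℕ} [NeZero N] {d : ZMod N → ℕ} (c : BellCoeff N n)
    (D : Devices N n d)
    (ρ : Matrix ((i : ZMod N) → Fin (d i)) ((i : ZMod N) → Fin (d i)) ℂ) : ℝ :=
  ∑ j, pairValue c D ρ j

/-- The density matrix `|ψ⟩⟨ψ|` of the AKLT state. -/
noncomputable def akltDensity (N : ℕ) [NeZero N] :
    Matrix (ZMod N → Fin 3) (ZMod N → Fin 3) ℂ :=
  Matrix.vecMulVec (akltState N) (star (akltState N : (ZMod N → Fin 3) → ℂ))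

/-- Devices for spins one whose cutting measurement is the measurement in the basis
`|0̃⟩, |1̃⟩, |2̃⟩`. -/
def CutsInBasis {N n : ℕ} [NeZero N] (D : Devices N n (fun _ => 3)) : Prop :=
  ∀ i o, D.cut i o = Matrix.single o o 1

/-- The scheme with `n` measured sites on each side of each pair detects the genuine multipartite
entanglement of the AKLT state in a device-independent way: some Bell expression takes a value on
the AKLT state that exceeds what biseparable states, of arbitrary local dimensions and with
arbitrary measurements, can reach. -/
def DetectsGME (N n : ℕ) [NeZero N] : Prop :=
  ∃ (c : BellCoeff N n) (D : Devices N n (fun _ => 3)) (b : ℝ), CutsInBasis D ∧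
    (∀ (d : ZMod N → ℕ) (D' : Devices N n d)
        (ρ : Matrix ((i : ZMod N) → Fin (d i)) ((i : ZMod N) → Fin (d i)) ℂ),
        IsBiseparable ρ → bellValue c D' ρ ≤ b) ∧
      b < bellValue c D (akltDensity N)

/-! Everything about the state rests on its matrix product form. Contracting the singlets turns
amplitudes into traces of ordered products of the matrices `mpsMat`, and squared amplitudes into
traces of products of transfer matrices. The transfer matrix with all outcomes allowed and the one
restricted to 2̃ are simultaneously diagonal (`modeMat`), so the probability of 2̃ on a set of sites
depends only on its size, and inclusion-exclusion over the two blocks gives the cutting probability.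
The ground state property is frustration freeness: up to a constant each bond term is twice the
projection onto total spin two, and two sites sharing a singlet have no spin-two component.

Cutting works because the matrices of 0̃ and 1̃ are multiples of matrix units and that of 2̃ is
diagonal. A block with an outcome other than 2̃ thus multiplies to a matrix unit, and one on each
side severs the trace and splits off the state of the pair (`IsCut.exists_factorization`). This
state is maximally entangled on two levels per site if i = k, and has Schmidt coefficients in the
ratio 2 : 1 otherwise. In both cases it is a top eigenvector of a tilted CHSH operator, scaled to
the common quantum bound 20 (`bell_eigenvector`, `tiltedOp_le`).

A state that is a product across `g` is a product across some pair with `j ∈ g`, `j + 1 ∉ g`. That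
pair obeys the local bound 6 + 2√41 < 20, every other pair the bound 20, and linearity extends the
resulting total to mixtures (`bellValue_le_of_biseparable`). The AKLT state reaches 20 times the
cutting probability on each pair, so the total falls short of 20N by at most 40N · 3⁻ⁿ. This is less
than the gap 20 - (6 + 2√41) once 3ⁿ is a large enough multiple of N. -/

/-! ### Tensor products of local operators -/

section PiOp

variable {ι : Type*} [Fintype ι] {d : ι → ℕ}

/-- The tensor product of local operators, over an arbitrary finite set of parties. -/
def piOp (E : (i : ι) → Matrix (Fin (d i)) (Fin (d i)) ℂ) :
    Matrix ((i : ι) → Fin (d i)) ((i : ι) → Fin (d i)) ℂ :=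
  Matrix.of fun s t => ∏ i, E i (s i) (t i)

theorem piOp_mul [DecidableEq ι] (E F : (i : ι) → Matrix (Fin (d i)) (Fin (d i)) ℂ) :
    piOp E * piOp F = piOp fun i => E i * F i := by
  ext s t
  simp only [piOp, Matrix.mul_apply, Matrix.of_apply, ← Finset.prod_mul_distrib]
  rw [Finset.prod_univ_sum, Fintype.piFinset_univ]

theorem piOp_one : piOp (fun i => (1 : Matrix (Fin (d i)) (Fin (d i)) ℂ)) = 1 := by
  ext s t
  simp only [piOp, Matrix.of_apply, Matrix.one_apply]
  by_cases h : s = t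
  · subst h; simp
  · obtain ⟨i, hi⟩ := Function.ne_iff.mp h
    rw [if_neg h]
    exact Finset.prod_eq_zero (Finset.mem_univ i) (if_neg hi)

theorem piOp_conjTranspose (E : (i : ι) → Matrix (Fin (d i)) (Fin (d i)) ℂ) :
    (piOp E).conjTranspose = piOp fun i => (E i).conjTranspose := by
  ext s t
  simp [piOp, Matrix.conjTranspose_apply]

open scoped MatrixOrder in
theorem Matrix.PosSemidef.exists_conjTranspose_mul_self {κ : Type*} [Fintype κ]
    {A : Matrix κ κ ℂ} (hA : A.PosSemidef) : ∃ B : Matrix κ κ ℂ, A = B.conjTranspose * B := by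
  classical
  exact CStarAlgebra.nonneg_iff_eq_star_mul_self.mp hA.nonneg

theorem piOp_posSemidef [DecidableEq ι] {E : (i : ι) → Matrix (Fin (d i)) (Fin (d i)) ℂ}
    (hE : ∀ i, (E i).PosSemidef) : (piOp E).PosSemidef := by
  choose B hB using fun i => (hE i).exists_conjTranspose_mul_self
  have : piOp E = (piOp B).conjTranspose * piOp B := by
    rw [piOp_conjTranspose, piOp_mul]
    exact congrArg _ (funext hB)
  rw [this]
  exact Matrix.posSemidef_conjTranspose_mul_self _

/-- Summing over the operator at one party. -/
theorem sum_piOp_of_eq_off [DecidableEq ι] {ω : Type*} [Fintype ω]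
    {E : ω → (i : ι) → Matrix (Fin (d i)) (Fin (d i)) ℂ}
    {G : (i : ι) → Matrix (Fin (d i)) (Fin (d i)) ℂ} (k : ι)
    (hE : ∀ a i, i ≠ k → E a i = G i) (hk : ∑ a, E a k = G k) :
    ∑ a, piOp (E a) = piOp G := by
  ext s t
  simp only [Matrix.sum_apply, piOp, Matrix.of_apply]
  rw [← Finset.mul_prod_erase _ _ (Finset.mem_univ k), ← hk, Matrix.sum_apply, Finset.sum_mul]
  refine Finset.sum_congr rfl fun a _ => ?_
  rw [← Finset.mul_prod_erase _ _ (Finset.mem_univ k)]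
  congr 1
  exact Finset.prod_congr rfl fun i hi => by rw [hE a i (Finset.ne_of_mem_erase hi)]

variable [DecidableEq ι]

/-- The embedding of the operators of party `i` into the operators of all parties. -/
def siteHom (i : ι) : Matrix (Fin (d i)) (Fin (d i)) ℂ →⋆ₐ[ℂ]
    Matrix ((i : ι) → Fin (d i)) ((i : ι) → Fin (d i)) ℂ where
  toFun A := piOp (Function.update (fun _ => 1) i A)
  map_one' := by
    rw [← piOp_one]
    congr 1
    exact Function.update_eq_self i (fun i => (1 : Matrix (Fin (d i)) (Fin (d i)) ℂ))
  map_mul' A B := by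
    rw [piOp_mul]
    congr 1
    funext k
    by_cases h : k = i
    · subst h; simp
    · simp [h]
  map_zero' := by
    ext s t
    simp only [piOp, Matrix.of_apply]
    exact Finset.prod_eq_zero (Finset.mem_univ i) (by simp)
  map_add' A B := by
    ext s t
    simp only [piOp, Matrix.of_apply, Matrix.add_apply]
    rw [← Finset.mul_prod_erase _ _ (Finset.mem_univ i),
      ← Finset.mul_prod_erase _ _ (Finset.mem_univ i),
      ← Finset.mul_prod_erase _ _ (Finset.mem_univ i)]
    have h : ∀ C : Matrix (Fin (d i)) (Fin (d i)) ℂ,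
        ∏ x ∈ Finset.univ.erase i, Function.update
          (fun i => (1 : Matrix (Fin (d i)) (Fin (d i)) ℂ)) i C x (s x) (t x) =
        ∏ x ∈ Finset.univ.erase i, (1 : Matrix (Fin (d x)) (Fin (d x)) ℂ) (s x) (t x) := fun C =>
      Finset.prod_congr rfl fun x hx => by rw [Function.update_of_ne (Finset.ne_of_mem_erase hx)]
    rw [h, h, h]
    simp [add_mul]
  commutes' r := by
    ext s t
    simp only [piOp, Matrix.of_apply]
    rw [← Finset.mul_prod_erase _ _ (Finset.mem_univ i), Finset.prod_congr rfl fun x hx => by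
      rw [Function.update_of_ne (Finset.ne_of_mem_erase hx)]]
    rw [Matrix.algebraMap_eq_diagonal, Matrix.algebraMap_eq_diagonal, ← mul_one r,
      Function.update_self]
    by_cases h : s = t
    · subst h; simp
    · rw [Matrix.diagonal_apply_ne _ h]
      obtain ⟨k, hk⟩ := Function.ne_iff.mp h
      by_cases hki : k = i
      · subst hki; simp [Matrix.diagonal_apply_ne _ hk]
      · rw [Finset.prod_eq_zero (Finset.mem_erase.mpr ⟨hki, Finset.mem_univ k⟩)
          (by rw [Matrix.one_apply_ne hk]), mul_zero]
  map_star' A := by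
    simp only [Matrix.star_eq_conjTranspose, piOp_conjTranspose]
    congr 1
    funext k
    by_cases h : k = i
    · subst h; simp
    · simp [h]

theorem siteHom_apply (i : ι) (A : Matrix (Fin (d i)) (Fin (d i)) ℂ) :
    siteHom i A = piOp (Function.update (fun _ => 1) i A) := rfl

/-- With the cutting operator as `piOp C`, trivial at the two Bell sites, this brings a joint
measurement operator into the form of a product of commuting operators to which the bipartite
quantum bound applies. -/
theorem siteHom_mul_siteHom_mul_piOp {i k : ι} (hik : i ≠ k)
    (A : Matrix (Fin (d i)) (Fin (d i)) ℂ) (B : Matrix (Fin (d k)) (Fin (d k)) ℂ)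
    {C G : (i : ι) → Matrix (Fin (d i)) (Fin (d i)) ℂ} (hi : C i = 1) (hk : C k = 1)
    (hGi : G i = A) (hGk : G k = B) (hG : ∀ l, l ≠ i → l ≠ k → G l = C l) :
    siteHom i A * siteHom k B * piOp C = piOp G := by
  rw [siteHom_apply, siteHom_apply, piOp_mul, piOp_mul]
  congr 1
  funext l
  by_cases h : l = i
  · subst h; simp [hik, hi, hGi]
  · by_cases h' : l = k
    · subst h'; simp [h, hk, hGk]
    · simp [h, h', hG l h h']

theorem siteHom_commute_piOp (i : ι) (A : Matrix (Fin (d i)) (Fin (d i)) ℂ)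
    {C : (i : ι) → Matrix (Fin (d i)) (Fin (d i)) ℂ} (hi : C i = 1) :
    Commute (siteHom i A) (piOp C) := by
  rw [Commute, SemiconjBy, siteHom_apply, piOp_mul, piOp_mul]
  congr 1
  funext l
  by_cases h : l = i
  · subst h; simp [hi]
  · simp [h]

theorem siteHom_commute {i k : ι} (hik : i ≠ k)
    (A : Matrix (Fin (d i)) (Fin (d i)) ℂ) (B : Matrix (Fin (d k)) (Fin (d k)) ℂ) :
    Commute (siteHom i A) (siteHom k B) :=
  siteHom_commute_piOp i A (by simp [hik])

end PiOp

/-! ### Positivity -/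

section Positivity

variable {κ : Type*} [Fintype κ]

/-- Writing `A` as C†C, cyclicity turns the trace into that of C B C†. -/
theorem trace_mul_nonneg_of_posSemidef {A B : Matrix κ κ ℂ} (hA : A.PosSemidef)
    (hB : B.PosSemidef) : 0 ≤ (A * B).trace := by
  obtain ⟨C, rfl⟩ := hA.exists_conjTranspose_mul_self
  rw [Matrix.mul_assoc, Matrix.trace_mul_comm]
  exact (hB.mul_mul_conjTranspose_same C).trace_nonneg

open scoped MatrixOrder in
theorem Matrix.PosSemidef.mul_of_commute {A B : Matrix κ κ ℂ} (hA : A.PosSemidef)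
    (hB : B.PosSemidef) (h : Commute A B) : (A * B).PosSemidef := by
  classical
  exact Matrix.nonneg_iff_posSemidef.mp (Commute.mul_nonneg hA.nonneg hB.nonneg h)

open Unitary in
/-- A real-linear functional on `{A | -1 ≤ A ≤ 1}` is maximized by an involution. -/
theorem exists_involution_le_map [DecidableEq κ] {E : Fin 2 → Matrix κ κ ℂ} (hE : IsPOVM E)
    (f : Matrix κ κ ℂ →ₗ[ℝ] ℝ) :
    ∃ A : Matrix κ κ ℂ, A.IsHermitian ∧ A * A = 1 ∧ f (E 0 - E 1) ≤ f A := by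
  have hO : (E 0 - E 1).IsHermitian := (hE.1 0).isHermitian.sub (hE.1 1).isHermitian
  have hsum : E 0 + E 1 = 1 := by simpa [Fin.sum_univ_two] using hE.2
  -- With the eigenvectors fixed, the functional is linear in the eigenvalues. Each eigenvalue lies
  -- in [-1, 1] and can be moved to the endpoint that the functional favours.
  set U := hO.eigenvectorUnitary with hU
  set l := hO.eigenvalues with hl
  have hspec : E 0 - E 1 = (U : Matrix κ κ ℂ) *
      (Matrix.diagonal (RCLike.ofReal ∘ l) : Matrix κ κ ℂ) * star (U : Matrix κ κ ℂ) := by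
    conv_lhs => rw [hO.spectral_theorem, conjStarAlgAut_apply]
  have hUU : (star (U : Matrix κ κ ℂ)) * (U : Matrix κ κ ℂ) = 1 := Unitary.coe_star_mul_self U
  have hUU' : (U : Matrix κ κ ℂ) * star (U : Matrix κ κ ℂ) = 1 := Unitary.coe_mul_star_self U
  -- In the eigenbasis the two effects have non-negative diagonal entries with sum 1 and difference
  -- `l k`.
  have hbound : ∀ k, |l k| ≤ 1 := by
    intro k
    have h0 := ((hE.1 0).conjTranspose_mul_mul_same (U : Matrix κ κ ℂ)).diag_nonneg (i := k)
    have h1 := ((hE.1 1).conjTranspose_mul_mul_same (U : Matrix κ κ ℂ)).diag_nonneg (i := k)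
    rw [← Matrix.star_eq_conjTranspose] at h0 h1
    have hs : star (U : Matrix κ κ ℂ) * E 0 * (U : Matrix κ κ ℂ) +
        star (U : Matrix κ κ ℂ) * E 1 * (U : Matrix κ κ ℂ) = 1 := by
      rw [← add_mul, ← mul_add, hsum, mul_one, hUU]
    have hd : star (U : Matrix κ κ ℂ) * E 0 * (U : Matrix κ κ ℂ) -
        star (U : Matrix κ κ ℂ) * E 1 * (U : Matrix κ κ ℂ) =
        (Matrix.diagonal (RCLike.ofReal ∘ l) : Matrix κ κ ℂ) := by
      rw [← sub_mul, ← mul_sub, hspec]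
      simp only [← mul_assoc, hUU, one_mul]
      rw [mul_assoc, hUU, mul_one]
    have hs' := congrArg (fun M : Matrix κ κ ℂ => (M k k).re) hs
    have hd' := congrArg (fun M : Matrix κ κ ℂ => (M k k).re) hd
    simp only [Matrix.add_apply, Matrix.sub_apply, Matrix.one_apply_eq, Matrix.diagonal_apply_eq,
      Complex.add_re, Complex.sub_re, Complex.one_re, Function.comp_apply] at hs' hd'
    have hre : ((RCLike.ofReal (l k) : ℂ)).re = l k := Complex.ofReal_re _
    rw [hre] at hd'
    have h0' := (Complex.le_def.mp h0).1
    have h1' := (Complex.le_def.mp h1).1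
    simp only [Complex.zero_re] at h0' h1'
    rw [abs_le]
    constructor <;> linarith
  let g : (κ → ℝ) →ₗ[ℝ] ℝ :=
    { toFun := fun v => f ((U : Matrix κ κ ℂ) * Matrix.diagonal (fun k => (v k : ℂ)) * star (U : Matrix κ κ ℂ))
      map_add' := fun v w => by
        rw [← map_add, ← add_mul, ← mul_add, Matrix.diagonal_add]
        simp
      map_smul' := fun c v => by
        rw [RingHom.id_apply, ← map_smul, ← smul_mul_assoc, ← mul_smul_comm]
        congr 3
        ext a b
        by_cases h : a = b
        · subst h; simp
        · simp [h] }
  have hg : ∀ v, g v = ∑ k, v k * g (Pi.single k 1) := fun v => by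
    conv_lhs => rw [← Finset.univ_sum_single v]
    rw [map_sum]
    refine Finset.sum_congr rfl fun k _ => ?_
    rw [← smul_eq_mul, ← map_smul, ← Pi.single_smul, smul_eq_mul, mul_one]
  let e : κ → ℝ := fun k => if 0 ≤ g (Pi.single k 1) then 1 else -1
  refine ⟨(U : Matrix κ κ ℂ) * Matrix.diagonal (fun k => (e k : ℂ)) * star (U : Matrix κ κ ℂ), ?_, ?_, ?_⟩
  · rw [Matrix.IsHermitian, ← Matrix.star_eq_conjTranspose, star_mul, star_mul, star_star,
      mul_assoc]
    congr 2
    rw [Matrix.star_eq_conjTranspose, Matrix.diagonal_conjTranspose]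
    congr 1
    ext k
    simp
  · calc _ = (U : Matrix κ κ ℂ) * (Matrix.diagonal (fun k => (e k : ℂ)) *
          (star (U : Matrix κ κ ℂ) * (U : Matrix κ κ ℂ)) * Matrix.diagonal (fun k => (e k : ℂ))) *
          star (U : Matrix κ κ ℂ) := by simp only [mul_assoc]
      _ = 1 := by
        rw [hUU, mul_one, Matrix.diagonal_mul_diagonal]
        have : (fun k => (e k : ℂ) * (e k : ℂ)) = fun _ => 1 := by
          funext k
          simp only [e]
          split_ifs <;> simp
        rw [this, Matrix.diagonal_one, mul_one, hUU']
  · have h1 : f (E 0 - E 1) = g l := congrArg f hspec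
    rw [h1]
    change g l ≤ g e
    rw [hg l, hg e]
    refine Finset.sum_le_sum fun k _ => ?_
    have := abs_le.mp (hbound k)
    simp only [e]
    split_ifs with h <;> nlinarith

end Positivity

/-! ### Tilted CHSH expressions -/

/-- The sign `(-1)^a` of an outcome. -/
def outcomeSign : Fin 2 → ℝ := ![1, -1]

/-- The coefficients of the tilted CHSH expression
`α A₀ + r (A₀ B₀ + A₀ B₁ + A₁ B₀ - A₁ B₁)`. -/
def tiltedCoeff (α r : ℝ) (x y a b : Fin 2) : ℝ :=
  outcomeSign a * (r * (if x = 1 ∧ y = 1 then -1 else 1) * outcomeSign b +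
    if x = 0 ∧ y = 0 then α else 0)

section Quantum

variable {κ κ₁ κ₂ : Type*} [Fintype κ] [DecidableEq κ] [Fintype κ₁] [DecidableEq κ₁]
  [Fintype κ₂] [DecidableEq κ₂]

/-- The operator of the tilted CHSH expression. -/
noncomputable def tiltedOp (α r : ℝ) (A₀ A₁ B₀ B₁ : Matrix κ κ ℂ) : Matrix κ κ ℂ :=
  α • A₀ + r • (A₀ * B₀ + A₀ * B₁ + A₁ * B₀ - A₁ * B₁)

theorem Commute.left_comm_assoc {R : Type*} [Semigroup R] {a b : R} (h : Commute a b) (c : R) :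
    b * (a * c) = a * (b * c) := by
  rw [← mul_assoc, ← h.eq, mul_assoc]

/-- Let S and T be the two brackets. Then S² = 4 - [A₀, A₁][B₀, B₁] and T² = 4 + [A₀, A₁][B₀, B₁].
The terms with αr are {A₀, S} - {A₁, T}, and both anticommutators equal 2(B₀ + B₁) + {A₀, A₁}(B₀ -
B₁). Only the constants survive. -/
theorem tilted_sum_of_squares {R : Type*} [Ring R] [Algebra ℝ R] {α r : ℝ} {A₀ A₁ B₀ B₁ : R}
    (hA₀ : A₀ * A₀ = 1) (hA₁ : A₁ * A₁ = 1) (hB₀ : B₀ * B₀ = 1) (hB₁ : B₁ * B₁ = 1)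
    (h₀₀ : Commute A₀ B₀) (h₀₁ : Commute A₀ B₁) (h₁₀ : Commute A₁ B₀) (h₁₁ : Commute A₁ B₁) :
    (α • A₀ + r • (A₀ * B₀ + A₀ * B₁ + A₁ * B₀ - A₁ * B₁)) *
        (α • A₀ + r • (A₀ * B₀ + A₀ * B₁ + A₁ * B₀ - A₁ * B₁)) +
      (α • A₁ - r • (A₀ * B₀ - A₀ * B₁ + A₁ * B₀ + A₁ * B₁)) *
        (α • A₁ - r • (A₀ * B₀ - A₀ * B₁ + A₁ * B₀ + A₁ * B₁)) =
      (2 * α ^ 2 + 8 * r ^ 2) • (1 : R) := by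
  have a0 : ∀ c, A₀ * (A₀ * c) = c := fun c => by rw [← mul_assoc, hA₀, one_mul]
  have a1 : ∀ c, A₁ * (A₁ * c) = c := fun c => by rw [← mul_assoc, hA₁, one_mul]
  simp only [mul_add, add_mul, mul_sub, sub_mul, smul_add, smul_sub, smul_mul_assoc,
    mul_smul_comm, mul_assoc, h₀₀.symm.eq, h₀₁.symm.eq, h₁₀.symm.eq, h₁₁.symm.eq,
    h₀₀.left_comm_assoc, h₀₁.left_comm_assoc, h₁₀.left_comm_assoc, h₁₁.left_comm_assoc,
    hA₀, hA₁, hB₀, hB₁, a0, a1, mul_one]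
  module

/-- If W² + M² = 400, then 20 - W = ((20 - W)² + M²)/40, a sum of squares of Hermitian operators. -/
theorem tiltedOp_le {α r : ℝ} (hαr : 2 * α ^ 2 + 8 * r ^ 2 = 400) {A₀ A₁ B₀ B₁ : Matrix κ κ ℂ}
    (hA₀ : A₀ * A₀ = 1) (hA₁ : A₁ * A₁ = 1) (hB₀ : B₀ * B₀ = 1) (hB₁ : B₁ * B₁ = 1)
    (h₀₀ : Commute A₀ B₀) (h₀₁ : Commute A₀ B₁) (h₁₀ : Commute A₁ B₀) (h₁₁ : Commute A₁ B₁)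
    (sA₀ : A₀.IsHermitian) (sA₁ : A₁.IsHermitian) (sB₀ : B₀.IsHermitian) (sB₁ : B₁.IsHermitian) :
    ((20 : ℝ) • (1 : Matrix κ κ ℂ) - tiltedOp α r A₀ A₁ B₀ B₁).PosSemidef := by
  have hS := tilted_sum_of_squares (α := α) (r := r) hA₀ hA₁ hB₀ hB₁ h₀₀ h₀₁ h₁₀ h₁₁
  rw [hαr] at hS
  set W := tiltedOp α r A₀ A₁ B₀ B₁ with hW
  set M := α • A₁ - r • (A₀ * B₀ - A₀ * B₁ + A₁ * B₀ + A₁ * B₁) with hM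
  have hWM : W * W + M * M = (400 : ℝ) • (1 : Matrix κ κ ℂ) := hS
  have p : ∀ {A B : Matrix κ κ ℂ}, A.IsHermitian → B.IsHermitian → Commute A B →
      (A * B).IsHermitian := fun hA hB h => by
    rw [Matrix.IsHermitian, Matrix.conjTranspose_mul, hA.eq, hB.eq, h.eq]
  have q : ∀ {A : Matrix κ κ ℂ} (c : ℝ), A.IsHermitian → (c • A).IsHermitian := fun c hA => by
    rw [Matrix.IsHermitian, Matrix.conjTranspose_smul, hA.eq, star_trivial]
  have sW : W.IsHermitian := (q α sA₀).add
    (q r ((((p sA₀ sB₀ h₀₀).add (p sA₀ sB₁ h₀₁)).add (p sA₁ sB₀ h₁₀)).sub (p sA₁ sB₁ h₁₁)))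
  have sM : M.IsHermitian := (q α sA₁).sub
    (q r ((((p sA₀ sB₀ h₀₀).sub (p sA₀ sB₁ h₀₁)).add (p sA₁ sB₀ h₁₀)).add (p sA₁ sB₁ h₁₁)))
  have s20 : ((20 : ℝ) • (1 : Matrix κ κ ℂ)).IsHermitian := q _ Matrix.isHermitian_one
  have key : (20 : ℝ) • (1 : Matrix κ κ ℂ) - W = (1 / 40 : ℝ) •
      (((20 : ℝ) • (1 : Matrix κ κ ℂ) - W).conjTranspose * ((20 : ℝ) • (1 : Matrix κ κ ℂ) - W) +
        M.conjTranspose * M) := by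
    rw [(s20.sub sW).eq, sM.eq]
    have : M * M = (400 : ℝ) • (1 : Matrix κ κ ℂ) - W * W := by rw [← hWM]; abel
    rw [this]
    simp only [mul_sub, sub_mul, smul_mul_assoc, mul_smul_comm, one_mul, mul_one]
    module
  rw [key]
  exact ((Matrix.posSemidef_conjTranspose_mul_self _).add
    (Matrix.posSemidef_conjTranspose_mul_self _)).smul (by norm_num)

/-- The quantum bound of tilted CHSH expressions. -/
theorem sum_tiltedCoeff_le {α r : ℝ} (hαr : 2 * α ^ 2 + 8 * r ^ 2 = 400)
    (Φ : Matrix κ₁ κ₁ ℂ →⋆ₐ[ℂ] Matrix κ κ ℂ) (Ψ : Matrix κ₂ κ₂ ℂ →⋆ₐ[ℂ] Matrix κ κ ℂ)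
    (hΦΨ : ∀ A B, Commute (Φ A) (Ψ B)) {ρ C : Matrix κ κ ℂ} (hρ : ρ.PosSemidef)
    (hC : C.PosSemidef) (hΦC : ∀ A, Commute (Φ A) C) (hΨC : ∀ B, Commute (Ψ B) C)
    {E : Fin 2 → Fin 2 → Matrix κ₁ κ₁ ℂ} {F : Fin 2 → Fin 2 → Matrix κ₂ κ₂ ℂ}
    (hE : ∀ x, IsPOVM (E x)) (hF : ∀ y, IsPOVM (F y)) :
    ∑ x, ∑ y, ∑ a, ∑ b, tiltedCoeff α r x y a b *
        (ρ * (Φ (E x a) * Ψ (F y b) * C)).trace.re ≤ 20 * (ρ * C).trace.re := by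
  let φ : Matrix κ κ ℂ →ₗ[ℝ] ℝ :=
    { toFun := fun X => (ρ * (X * C)).trace.re
      map_add' := fun X Y => by simp [add_mul, mul_add]
      map_smul' := fun c X => by simp }
  let L : Matrix κ κ ℂ → Matrix κ₁ κ₁ ℂ →ₗ[ℝ] ℝ := fun Y =>
    { toFun := fun A => φ (Φ A * Y)
      map_add' := fun A B => by simp [add_mul]
      map_smul' := fun c A => by
        rw [RingHom.id_apply, ← map_smul, ← smul_mul_assoc]
        congr 2
        rw [← Complex.coe_smul, map_smul, Complex.coe_smul] }
  let R : Matrix κ κ ℂ → Matrix κ₂ κ₂ ℂ →ₗ[ℝ] ℝ := fun X =>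
    { toFun := fun B => φ (X * Ψ B)
      map_add' := fun A B => by simp [mul_add]
      map_smul' := fun c A => by
        rw [RingHom.id_apply, ← map_smul, ← mul_smul_comm]
        congr 2
        rw [← Complex.coe_smul, map_smul, Complex.coe_smul] }
  have hL : ∀ Y A, L Y A = φ (Φ A * Y) := fun _ _ => rfl
  have hR : ∀ X B, R X B = φ (X * Ψ B) := fun _ _ => rfl
  let V : Matrix κ₁ κ₁ ℂ → Matrix κ₁ κ₁ ℂ → Matrix κ₂ κ₂ ℂ → Matrix κ₂ κ₂ ℂ → ℝ :=
    fun A₀ A₁ B₀ B₁ => φ (tiltedOp α r (Φ A₀) (Φ A₁) (Ψ B₀) (Ψ B₁))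
  have hV : ∀ A₀ A₁ B₀ B₁, V A₀ A₁ B₀ B₁ = α * φ (Φ A₀) + r * (φ (Φ A₀ * Ψ B₀) +
      φ (Φ A₀ * Ψ B₁) + φ (Φ A₁ * Ψ B₀) - φ (Φ A₁ * Ψ B₁)) := fun _ _ _ _ => by
    simp only [V, tiltedOp, map_add, map_smul, map_sub, smul_eq_mul]
  -- No term of the value contains two observables of the same party. So A₀ and A₁ can be optimized
  -- separately against the given observables of the other side, and then B₀ and B₁ against the new
  -- A₀ and A₁. This reduces arbitrary effects to involutions in the same dimension.
  obtain ⟨A₀, sA₀, hA₀, lA₀⟩ := exists_involution_le_map (hE 0)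
    (L (α • 1 + r • (Ψ (F 0 0 - F 0 1) + Ψ (F 1 0 - F 1 1))))
  obtain ⟨A₁, sA₁, hA₁, lA₁⟩ := exists_involution_le_map (hE 1)
    (L (r • (Ψ (F 0 0 - F 0 1) - Ψ (F 1 0 - F 1 1))))
  obtain ⟨B₀, sB₀, hB₀, lB₀⟩ := exists_involution_le_map (hF 0) (R (r • (Φ A₀ + Φ A₁)))
  obtain ⟨B₁, sB₁, hB₁, lB₁⟩ := exists_involution_le_map (hF 1) (R (r • (Φ A₀ - Φ A₁)))
  have hval : ∑ x, ∑ y, ∑ a, ∑ b, tiltedCoeff α r x y a b *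
      (ρ * (Φ (E x a) * Ψ (F y b) * C)).trace.re =
      V (E 0 0 - E 0 1) (E 1 0 - E 1 1) (F 0 0 - F 0 1) (F 1 0 - F 1 1) := by
    -- The tilt is recorded under the settings (0, 0); summing over the outcome `b` turns it into
    -- the marginal of A₀.
    have hF0 : F 0 0 + F 0 1 = 1 := by simpa [Fin.sum_univ_two] using (hF 0).2
    have hm : ∀ A, φ (Φ A) = φ (Φ A * Ψ (F 0 0)) + φ (Φ A * Ψ (F 0 1)) := fun A => by
      rw [← map_add, ← mul_add, ← map_add, hF0, map_one, mul_one]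
    rw [hV, hm]
    change ∑ x, ∑ y, ∑ a, ∑ b, tiltedCoeff α r x y a b * φ (Φ (E x a) * Ψ (F y b)) = _
    simp only [Fin.sum_univ_two, tiltedCoeff, outcomeSign, map_sub, sub_mul, mul_sub]
    simp
    ring
  have h1 : V (E 0 0 - E 0 1) (E 1 0 - E 1 1) (F 0 0 - F 0 1) (F 1 0 - F 1 1) ≤
      V A₀ A₁ (F 0 0 - F 0 1) (F 1 0 - F 1 1) := by
    rw [hV, hV]
    simp only [hL, mul_add, mul_sub, mul_smul_comm, mul_one, map_add, map_smul, smul_eq_mul,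
      map_sub] at lA₀ lA₁ ⊢
    linarith
  have h2 : V A₀ A₁ (F 0 0 - F 0 1) (F 1 0 - F 1 1) ≤ V A₀ A₁ B₀ B₁ := by
    rw [hV, hV]
    simp only [hR, add_mul, sub_mul, smul_mul_assoc, map_add, map_smul, smul_eq_mul, map_sub,
      mul_sub, mul_add] at lB₀ lB₁ ⊢
    linarith
  have h3 : V A₀ A₁ B₀ B₁ ≤ 20 * (ρ * C).trace.re := by
    have sq : ∀ {A : Matrix κ₁ κ₁ ℂ}, A * A = 1 → Φ A * Φ A = 1 := fun h => by
      rw [← map_mul, h, map_one]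
    have sq' : ∀ {B : Matrix κ₂ κ₂ ℂ}, B * B = 1 → Ψ B * Ψ B = 1 := fun h => by
      rw [← map_mul, h, map_one]
    have sa : ∀ {A : Matrix κ₁ κ₁ ℂ}, A.IsHermitian → (Φ A).IsHermitian := fun {A} h => by
      have := map_star Φ A
      rw [Matrix.star_eq_conjTranspose, h.eq] at this
      exact this.symm
    have sb : ∀ {B : Matrix κ₂ κ₂ ℂ}, B.IsHermitian → (Ψ B).IsHermitian := fun {B} h => by
      have := map_star Ψ B
      rw [Matrix.star_eq_conjTranspose, h.eq] at this
      exact this.symm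
    have hpos := tiltedOp_le hαr (sq hA₀) (sq hA₁) (sq' hB₀) (sq' hB₁) (hΦΨ _ _) (hΦΨ _ _)
      (hΦΨ _ _) (hΦΨ _ _) (sa sA₀) (sa sA₁) (sb sB₀) (sb sB₁)
    have smulc : ∀ (c : ℝ) {X : Matrix κ κ ℂ}, Commute X C → Commute (c • X) C :=
      fun c X h => h.smul_left c
    have hcomm : Commute ((20 : ℝ) • (1 : Matrix κ κ ℂ) -
        tiltedOp α r (Φ A₀) (Φ A₁) (Ψ B₀) (Ψ B₁)) C := by
      refine (smulc _ (Commute.one_left C)).sub_left ((smulc _ (hΦC _)).add_left (smulc _ ?_))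
      exact ((((hΦC _).mul_left (hΨC _)).add_left ((hΦC _).mul_left (hΨC _))).add_left
        ((hΦC _).mul_left (hΨC _))).sub_left ((hΦC _).mul_left (hΨC _))
    have := (Complex.le_def.mp (trace_mul_nonneg_of_posSemidef hρ (hpos.mul_of_commute hC hcomm))).1
    have h20 : φ ((20 : ℝ) • (1 : Matrix κ κ ℂ) -
        tiltedOp α r (Φ A₀) (Φ A₁) (Ψ B₀) (Ψ B₁)) = 20 * φ 1 - V A₀ A₁ B₀ B₁ := by
      rw [map_sub, map_smul, smul_eq_mul]
    have h21 : φ 1 = (ρ * C).trace.re := by simp [φ]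
    change 0 ≤ φ _ at this
    rw [h20, h21] at this
    linarith
  rw [hval]
  exact h1.trans (h2.trans h3)

end Quantum

/-- The local bound of tilted CHSH expressions, for products of subnormalized distributions. -/
theorem sum_tiltedCoeff_mul_le {α r U V : ℝ} (hα : 0 ≤ α) (hr : 0 ≤ r)
    {u v : Fin 2 → Fin 2 → ℝ} (hu : ∀ x a, 0 ≤ u x a) (hv : ∀ y b, 0 ≤ v y b)
    (hU : ∀ x, ∑ a, u x a = U) (hV : ∀ y, ∑ b, v y b = V) :
    ∑ x, ∑ y, ∑ a, ∑ b, tiltedCoeff α r x y a b * (u x a * v y b) ≤ (α + 2 * r) * (U * V) := by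
  simp only [Fin.sum_univ_two] at hU hV
  have hval : ∑ x, ∑ y, ∑ a, ∑ b, tiltedCoeff α r x y a b * (u x a * v y b) =
      α * ((u 0 0 - u 0 1) * (v 0 0 + v 0 1)) +
      r * ((u 0 0 - u 0 1) * ((v 0 0 - v 0 1) + (v 1 0 - v 1 1)) +
        (u 1 0 - u 1 1) * ((v 0 0 - v 0 1) - (v 1 0 - v 1 1))) := by
    simp [Fin.sum_univ_two, tiltedCoeff, outcomeSign]
    ring
  have hbd : ∀ {a b : ℝ}, |a| ≤ U → a * b ≤ U * |b| := fun {a b} h =>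
    (le_abs_self _).trans (by rw [abs_mul]; gcongr)
  have hu' : ∀ x, |u x 0 - u x 1| ≤ U := fun x => by
    rw [abs_le]; constructor <;> linarith [hu x 0, hu x 1, hU x]
  have hv' : ∀ y, |v y 0 - v y 1| ≤ V := fun y => by
    rw [abs_le]; constructor <;> linarith [hv y 0, hv y 1, hV y]
  have hU0 : 0 ≤ U := (abs_nonneg _).trans (hu' 0)
  have hV0 : 0 ≤ V := (abs_nonneg _).trans (hv' 0)
  have h1 : (u 0 0 - u 0 1) * (v 0 0 + v 0 1) ≤ U * V := by
    rw [hV 0]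
    exact mul_le_mul_of_nonneg_right ((le_abs_self _).trans (hu' 0)) hV0
  -- |p + q| + |p - q| is twice the larger of |p| and |q|.
  have h2 : |(v 0 0 - v 0 1) + (v 1 0 - v 1 1)| + |(v 0 0 - v 0 1) - (v 1 0 - v 1 1)| ≤ 2 * V := by
    have h0 := abs_le.mp (hv' 0)
    have h1 := abs_le.mp (hv' 1)
    rcases abs_cases ((v 0 0 - v 0 1) + (v 1 0 - v 1 1)) with ⟨e, _⟩ | ⟨e, _⟩ <;>
    rcases abs_cases ((v 0 0 - v 0 1) - (v 1 0 - v 1 1)) with ⟨e', _⟩ | ⟨e', _⟩ <;>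
    rw [e, e'] <;> linarith
  rw [hval]
  have h3 := hbd (b := (v 0 0 - v 0 1) + (v 1 0 - v 1 1)) (hu' 0)
  have h4 := hbd (b := (v 0 0 - v 0 1) - (v 1 0 - v 1 1)) (hu' 1)
  have h5 := mul_le_mul_of_nonneg_left h2 hU0
  have h6 := mul_le_mul_of_nonneg_left h1 hα
  have h7 : (u 0 0 - u 0 1) * ((v 0 0 - v 0 1) + (v 1 0 - v 1 1)) +
        (u 1 0 - u 1 1) * ((v 0 0 - v 0 1) - (v 1 0 - v 1 1)) ≤ 2 * (U * V) := by linarith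
  have h8 := mul_le_mul_of_nonneg_left h7 hr
  linarith

/-! ### The geometry of the ring -/

section Ring

variable {N : ℕ}

/-- All questions of distinctness of sites are reduced to comparing offsets from a common base point
as natural numbers below `N`. -/
theorem zmod_add_natCast_inj {j : ZMod N} {a b : ℕ} (ha : a < N) (hb : b < N)
    (h : j + (a : ZMod N) = j + (b : ZMod N)) : a = b := by
  have h' := (ZMod.natCast_eq_natCast_iff' a b N).mp (add_left_cancel h)
  rwa [Nat.mod_eq_of_lt ha, Nat.mod_eq_of_lt hb] at h'

/-- Offsets are counted from the leftmost measured site `j - n`: the left block occupies 0 to n - 1,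
the pair n and n + 1, the right block n + 2 to 2n + 1. This window does not overlap itself when 2n +
2 ≤ N. -/
theorem mem_leftBlock {j i : ZMod N} {n : ℕ} :
    i ∈ leftBlock j n ↔ ∃ k < n, i = j - n + (k : ZMod N) := by
  simp only [leftBlock, Finset.mem_image, Finset.mem_range]
  constructor
  · rintro ⟨k, hk, rfl⟩
    refine ⟨n - 1 - k, by omega, ?_⟩
    rw [Nat.cast_sub (by omega), Nat.cast_sub (by omega)]
    push_cast
    ring
  · rintro ⟨k, hk, rfl⟩
    refine ⟨n - 1 - k, by omega, ?_⟩
    rw [Nat.cast_sub (by omega), Nat.cast_sub (by omega)]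
    push_cast
    ring

theorem mem_rightBlock {j i : ZMod N} {n : ℕ} :
    i ∈ rightBlock j n ↔ ∃ k < n, i = j - n + ((n + 2 + k : ℕ) : ZMod N) := by
  simp only [rightBlock, Finset.mem_image, Finset.mem_range]
  constructor
  · rintro ⟨k, hk, rfl⟩
    exact ⟨k, hk, by push_cast; ring⟩
  · rintro ⟨k, hk, rfl⟩
    exact ⟨k, hk, by push_cast; ring⟩

theorem self_eq_sub_add (j : ZMod N) (n : ℕ) : j = j - n + (n : ZMod N) := by ring

theorem add_one_eq_sub_add (j : ZMod N) (n : ℕ) :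
    j + 1 = j - n + ((n + 1 : ℕ) : ZMod N) := by push_cast; ring

variable {n : ℕ}

theorem self_ne_add_one (hN : 2 ≤ N) (j : ZMod N) : j ≠ j + 1 := by
  intro h
  have := zmod_add_natCast_inj (N := N) (j := j) (a := 0) (b := 1) (by omega) (by omega)
    (by simpa using h)
  omega

theorem self_notMem_blocks (hN : 2 * n + 2 ≤ N) (j : ZMod N) :
    j ∉ leftBlock j n ∪ rightBlock j n := by
  rw [Finset.mem_union, mem_leftBlock, mem_rightBlock]
  rintro (⟨k, hk, h⟩ | ⟨k, hk, h⟩) <;> replace h := (self_eq_sub_add j n).symm.trans h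
  · have := zmod_add_natCast_inj (by omega) (by omega) h; omega
  · have := zmod_add_natCast_inj (by omega) (by omega) h; omega

theorem add_one_notMem_blocks (hN : 2 * n + 2 ≤ N) (j : ZMod N) :
    j + 1 ∉ leftBlock j n ∪ rightBlock j n := by
  rw [Finset.mem_union, mem_leftBlock, mem_rightBlock, add_one_eq_sub_add j n]
  rintro (⟨k, hk, h⟩ | ⟨k, hk, h⟩)
  · have := zmod_add_natCast_inj (by omega) (by omega) h; omega
  · have := zmod_add_natCast_inj (by omega) (by omega) h; omega

theorem card_leftBlock (hN : 2 * n + 2 ≤ N) (j : ZMod N) : (leftBlock j n).card = n := by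
  rw [leftBlock, Finset.card_image_of_injOn, Finset.card_range]
  intro a ha b hb h
  have ha' := Finset.mem_range.mp ha
  have hb' := Finset.mem_range.mp hb
  refine zmod_add_natCast_inj (N := N) (j := 0) (by omega) (by omega) ?_
  simpa using h

theorem card_rightBlock (hN : 2 * n + 2 ≤ N) (j : ZMod N) : (rightBlock j n).card = n := by
  rw [rightBlock, Finset.card_image_of_injOn, Finset.card_range]
  intro a ha b hb h
  have ha' := Finset.mem_range.mp ha
  have hb' := Finset.mem_range.mp hb
  exact zmod_add_natCast_inj (N := N) (by omega) (by omega) h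

theorem disjoint_blocks (hN : 2 * n + 2 ≤ N) (j : ZMod N) :
    Disjoint (leftBlock j n) (rightBlock j n) := by
  rw [Finset.disjoint_left]
  intro i hl hr
  obtain ⟨k, hk, rfl⟩ := mem_leftBlock.mp hl
  obtain ⟨l, hl, h⟩ := mem_rightBlock.mp hr
  have := zmod_add_natCast_inj (by omega) (by omega) h
  omega

theorem card_blocks (hN : 2 * n + 2 ≤ N) (j : ZMod N) :
    (leftBlock j n ∪ rightBlock j n).card = 2 * n := by
  rw [Finset.card_union_of_disjoint (disjoint_blocks hN j), card_leftBlock hN,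
    card_rightBlock hN, two_mul]

theorem card_branch (hN : 2 * n + 2 ≤ N) (j : ZMod N) :
    Fintype.card (Branch j n) = 3 ^ (2 * n) := by
  rw [Fintype.card_fun, Fintype.card_fin, Fintype.card_coe, card_blocks hN]

variable [NeZero N]

/-- A non-trivial set of sites has a site whose right neighbour is outside. -/
theorem exists_mem_add_one_notMem {g : Finset (ZMod N)} (hg : g.Nonempty) (hg' : gᶜ.Nonempty) :
    ∃ j ∈ g, j + 1 ∉ g := by
  by_contra! h
  obtain ⟨i, hi⟩ := hg
  obtain ⟨k, hk⟩ := hg'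
  -- Otherwise `g` is closed under passing to the right neighbour and contains the whole ring.
  have hall : ∀ m : ℕ, i + (m : ZMod N) ∈ g := by
    intro m
    induction m with
    | zero => simpa using hi
    | succ m ih => simpa [add_assoc] using h _ ih
  have := hall (k - i).val
  rw [ZMod.natCast_zmod_val, add_sub_cancel] at this
  exact Finset.mem_compl.mp hk this

end Ring

/-! ### Bounds on the values of multipartite Bell expressions -/

section Bounds

variable {N n : ℕ} [NeZero N] {d : ZMod N → ℕ}

/-- The local operators of the outcomes `μ` of the cutting measurements. -/
noncomputable def cutLocal (D : Devices N n d) {j : ZMod N} (μ : Branch j n) (i : ZMod N) :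
    Matrix (Fin (d i)) (Fin (d i)) ℂ :=
  if h : i ∈ leftBlock j n ∪ rightBlock j n then D.cut i (μ ⟨i, h⟩) else 1

theorem cutLocal_posSemidef (D : Devices N n d) {j : ZMod N} (μ : Branch j n) (i : ZMod N) :
    (cutLocal D μ i).PosSemidef := by
  unfold cutLocal
  split_ifs with h
  · exact (D.cut_povm i).1 _
  · exact Matrix.PosSemidef.one

theorem cutLocal_of_notMem (D : Devices N n d) {j : ZMod N} (μ : Branch j n) {i : ZMod N}
    (h : i ∉ leftBlock j n ∪ rightBlock j n) : cutLocal D μ i = 1 := dif_neg h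

/-- Expanding the product, over the measured sites, of the sums of their effects yields one term per
branch, and each of these sums is 1. -/
theorem sum_piOp_cutLocal (D : Devices N n d) (j : ZMod N) :
    ∑ μ : Branch j n, piOp (cutLocal D μ) = 1 := by
  rw [← piOp_one]
  ext s t
  simp only [Matrix.sum_apply, piOp, Matrix.of_apply]
  have h : ∀ μ : Branch j n, ∏ i, cutLocal D μ i (s i) (t i) =
      (∏ i : {i // i ∈ leftBlock j n ∪ rightBlock j n}, D.cut i (μ i) (s i) (t i)) *
        ∏ i : {i // i ∉ leftBlock j n ∪ rightBlock j n},
          (1 : Matrix (Fin (d i)) (Fin (d i)) ℂ) (s i) (t i) := fun μ => by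
    rw [← Fintype.prod_subtype_mul_prod_subtype (fun i => i ∈ leftBlock j n ∪ rightBlock j n)]
    congr 1
    · exact Finset.prod_congr (Finset.ext fun i => by simp) fun i _ => by rw [cutLocal, dif_pos i.2]
    · exact Finset.prod_congr (Finset.ext fun i => by simp) fun i _ => by rw [cutLocal, dif_neg i.2]
  rw [Finset.sum_congr rfl fun μ _ => h μ, ← Finset.sum_mul,
    ← Fintype.prod_subtype_mul_prod_subtype (fun i => i ∈ leftBlock j n ∪ rightBlock j n)]
  congr 1
  have := Finset.prod_univ_sum (fun _ : {i // i ∈ leftBlock j n ∪ rightBlock j n} =>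
    (Finset.univ : Finset (Fin 3))) (fun i o => D.cut i o (s i) (t i))
  rw [Fintype.piFinset_univ] at this
  rw [← this]
  refine Finset.prod_congr (Finset.ext fun i => by simp) fun i _ => ?_
  rw [← (D.cut_povm i).2, Matrix.sum_apply]

/-- The probability of the outcomes `μ` of the cutting measurements. -/
noncomputable def cutWeight (D : Devices N n d)
    (ρ : Matrix ((i : ZMod N) → Fin (d i)) ((i : ZMod N) → Fin (d i)) ℂ) {j : ZMod N}
    (μ : Branch j n) : ℝ :=
  (ρ * piOp (cutLocal D μ)).trace.re

theorem cutWeight_nonneg (D : Devices N n d)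
    {ρ : Matrix ((i : ZMod N) → Fin (d i)) ((i : ZMod N) → Fin (d i)) ℂ} (hρ : IsDensity ρ)
    {j : ZMod N} (μ : Branch j n) : 0 ≤ cutWeight D ρ μ :=
  (Complex.le_def.mp (trace_mul_nonneg_of_posSemidef hρ.1
    (piOp_posSemidef (cutLocal_posSemidef D μ)))).1

theorem sum_cutWeight (D : Devices N n d)
    {ρ : Matrix ((i : ZMod N) → Fin (d i)) ((i : ZMod N) → Fin (d i)) ℂ} (hρ : IsDensity ρ)
    (j : ZMod N) : ∑ μ : Branch j n, cutWeight D ρ μ = 1 := by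
  simp only [cutWeight]
  rw [← Complex.re_sum, ← Matrix.trace_sum, ← Matrix.mul_sum, sum_piOp_cutLocal, mul_one, hρ.2,
    Complex.one_re]

theorem jointProb_eq (hN : 2 * n + 2 ≤ N) (D : Devices N n d)
    (ρ : Matrix ((i : ZMod N) → Fin (d i)) ((i : ZMod N) → Fin (d i)) ℂ)
    (j : ZMod N) (μ : Branch j n) (x y a b : Fin 2) :
    jointProb D ρ j μ x y a b = (ρ * (siteHom j (D.bell j j μ x a) *
      siteHom (j + 1) (D.bell (j + 1) j μ y b) * piOp (cutLocal D μ))).trace.re := by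
  have hj := self_ne_add_one (by omega) j
  rw [siteHom_mul_siteHom_mul_piOp hj _ _ (cutLocal_of_notMem D μ (self_notMem_blocks hN j))
    (cutLocal_of_notMem D μ (add_one_notMem_blocks hN j))
    (G := fun i => if i = j then D.bell i j μ x a
      else if i = j + 1 then D.bell i j μ y b else cutLocal D μ i)
    (by simp) (by simp [hj.symm]) (fun l h h' => by simp [h, h'])]
  rfl

/-- A bipartite Bell expression that vanishes or is a tilted CHSH expression with quantum bound
`20` and local bound at most `β`. -/
def IsTiltedOrZero (β : ℝ) (c : Fin 2 → Fin 2 → Fin 2 → Fin 2 → ℝ) : Prop :=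
  c = 0 ∨ ∃ α r : ℝ, 0 ≤ α ∧ 0 ≤ r ∧ 2 * α ^ 2 + 8 * r ^ 2 = 400 ∧ α + 2 * r ≤ β ∧
    c = tiltedCoeff α r

/-- The quantum bound, used in each branch with the cutting operator as `C`, gives 20 times the
weight of the branch, and the weights sum to 1. -/
theorem pairValue_le (hN : 2 * n + 2 ≤ N) {β : ℝ} {c : BellCoeff N n}
    (hc : ∀ j μ, IsTiltedOrZero β (c j μ)) (D : Devices N n d)
    {ρ : Matrix ((i : ZMod N) → Fin (d i)) ((i : ZMod N) → Fin (d i)) ℂ} (hρ : IsDensity ρ)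
    (j : ZMod N) : pairValue c D ρ j ≤ 20 := by
  have hbranch : ∀ μ : Branch j n, ∑ x, ∑ y, ∑ a, ∑ b, c j μ x y a b * jointProb D ρ j μ x y a b ≤
      20 * cutWeight D ρ μ := by
    intro μ
    rcases hc j μ with h | ⟨α, r, -, -, hαr, -, h⟩
    · simpa [h] using cutWeight_nonneg D hρ μ
    · simp only [h, jointProb_eq hN]
      exact sum_tiltedCoeff_le hαr (siteHom j) (siteHom (j + 1))
        (siteHom_commute (self_ne_add_one (by omega) j)) hρ.1
        (piOp_posSemidef (cutLocal_posSemidef D μ))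
        (fun A => siteHom_commute_piOp j A (cutLocal_of_notMem D μ (self_notMem_blocks hN j)))
        (fun A => siteHom_commute_piOp _ A (cutLocal_of_notMem D μ (add_one_notMem_blocks hN j)))
        (fun x => D.bell_povm j j μ x) (fun y => D.bell_povm (j + 1) j μ y)
  calc pairValue c D ρ j ≤ ∑ μ : Branch j n, 20 * cutWeight D ρ μ :=
        Finset.sum_le_sum fun μ _ => hbranch μ
    _ = 20 := by rw [← Finset.mul_sum, sum_cutWeight D hρ, mul_one]

/-- Configurations split into a part on `g` and a part off `g`, and the state and the product
operator both split accordingly. -/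
theorem trace_mul_piOp_of_product {g : Finset (ZMod N)}
    {ρ : Matrix ((i : ZMod N) → Fin (d i)) ((i : ZMod N) → Fin (d i)) ℂ}
    {ρ₁ : Matrix ((i : {i // i ∈ g}) → Fin (d i)) ((i : {i // i ∈ g}) → Fin (d i)) ℂ}
    {ρ₂ : Matrix ((i : {i // i ∉ g}) → Fin (d i)) ((i : {i // i ∉ g}) → Fin (d i)) ℂ}
    (h : ∀ s t, ρ s t = ρ₁ (fun i => s i) (fun i => t i) * ρ₂ (fun i => s i) (fun i => t i))
    (E : (i : ZMod N) → Matrix (Fin (d i)) (Fin (d i)) ℂ) :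
    (ρ * piOp E).trace =
      (ρ₁ * piOp (d := fun i : {i // i ∈ g} => d i) fun i => E i).trace *
        (ρ₂ * piOp (d := fun i : {i // i ∉ g} => d i) fun i => E i).trace := by
  let e := Equiv.piEquivPiSubtypeProd (fun i => i ∈ g) fun i => Fin (d i)
  let T₁ := fun s t : (i : {i // i ∈ g}) → Fin (d i) => ρ₁ s t * ∏ i : {i // i ∈ g}, E i (t i) (s i)
  let T₂ := fun s t : (i : {i // i ∉ g}) → Fin (d i) =>
    ρ₂ s t * ∏ i : {i // i ∉ g}, E i (t i) (s i)
  have h1 : (ρ * piOp E).trace =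
      ∑ s, ∑ t, T₁ (e s).1 (e t).1 * T₂ (e s).2 (e t).2 := by
    simp only [Matrix.trace, Matrix.diag_apply, Matrix.mul_apply, piOp, Matrix.of_apply]
    refine Finset.sum_congr rfl fun s _ => Finset.sum_congr rfl fun t _ => ?_
    rw [h, ← Fintype.prod_subtype_mul_prod_subtype (fun i => i ∈ g)]
    rw [mul_mul_mul_comm]
    refine congrArg₂ (· * ·) (congrArg₂ (· * ·) rfl ?_) (congrArg₂ (· * ·) rfl ?_)
    · exact Finset.prod_congr (Finset.ext fun i => by simp) fun i _ => rfl
    · exact Finset.prod_congr (Finset.ext fun i => by simp) fun i _ => rfl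
  rw [h1, e.sum_comp (fun p => ∑ t, T₁ p.1 (e t).1 * T₂ p.2 (e t).2),
    Finset.sum_congr rfl fun p _ => e.sum_comp (fun q => T₁ p.1 q.1 * T₂ p.2 q.2)]
  have h2 : ∀ p : ((i : {i // i ∈ g}) → Fin (d i)) × ((i : {i // i ∉ g}) → Fin (d i)),
      ∑ q : ((i : {i // i ∈ g}) → Fin (d i)) × ((i : {i // i ∉ g}) → Fin (d i)),
        T₁ p.1 q.1 * T₂ p.2 q.2 = (∑ t, T₁ p.1 t) * ∑ t, T₂ p.2 t := fun p => by
    rw [Finset.sum_mul_sum, Fintype.sum_prod_type]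
  rw [Finset.sum_congr rfl fun p _ => h2 p, Fintype.sum_prod_type]
  simp only [← Finset.mul_sum, ← Finset.sum_mul]
  rfl

theorem IsProductAcross.isDensity {g : Finset (ZMod N)}
    {ρ : Matrix ((i : ZMod N) → Fin (d i)) ((i : ZMod N) → Fin (d i)) ℂ}
    (h : IsProductAcross g ρ) : IsDensity ρ := by
  obtain ⟨ρ₁, ρ₂, h₁, h₂, h⟩ := h
  constructor
  · have : ρ = (Matrix.kronecker ρ₁ ρ₂).submatrix
        (Equiv.piEquivPiSubtypeProd (fun i => i ∈ g) fun i => Fin (d i))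
        (Equiv.piEquivPiSubtypeProd (fun i => i ∈ g) fun i => Fin (d i)) := by
      ext s t
      exact h s t
    rw [this]
    exact (h₁.1.kronecker h₂.1).submatrix _
  · have := trace_mul_piOp_of_product h fun _ => 1
    rwa [piOp_one, piOp_one, piOp_one, mul_one, mul_one, mul_one, h₁.2, h₂.2, mul_one] at this

/-- Cutting measurements are local, so each branch preserves the product across `g`. As the two
parties of the pair are on opposite sides, their joint distribution within a branch is a product of
two subnormalized distributions, to which the local bound applies. -/
theorem pairValue_le_of_product (hN : 2 * n + 2 ≤ N) {β : ℝ} (hβ : 0 ≤ β) {c : BellCoeff N n}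
    (hc : ∀ j μ, IsTiltedOrZero β (c j μ)) (D : Devices N n d)
    {ρ : Matrix ((i : ZMod N) → Fin (d i)) ((i : ZMod N) → Fin (d i)) ℂ}
    {g : Finset (ZMod N)} (hρ : IsProductAcross g ρ) {j : ZMod N} (hj : j ∈ g) (hj' : j + 1 ∉ g) :
    pairValue c D ρ j ≤ β := by
  have hdens := hρ.isDensity
  obtain ⟨ρ₁, ρ₂, h₁, h₂, h⟩ := hρ
  have hne := self_ne_add_one (N := N) (by omega) j
  have hbranch : ∀ μ : Branch j n, ∑ x, ∑ y, ∑ a, ∑ b, c j μ x y a b * jointProb D ρ j μ x y a b ≤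
      β * cutWeight D ρ μ := by
    intro μ
    rcases hc j μ with hc | ⟨α, r, hα, hr, -, hβ', hc⟩
    · simpa [hc] using mul_nonneg hβ (cutWeight_nonneg D hdens μ)
    let G₁ : Fin 2 → Fin 2 → (i : ZMod N) → Matrix (Fin (d i)) (Fin (d i)) ℂ := fun x a i =>
      if i = j then D.bell i j μ x a else cutLocal D μ i
    let G₂ : Fin 2 → Fin 2 → (i : ZMod N) → Matrix (Fin (d i)) (Fin (d i)) ℂ := fun y b i =>
      if i = j + 1 then D.bell i j μ y b else cutLocal D μ i
    have hG₁ : ∀ x a i, (G₁ x a i).PosSemidef := fun x a i => by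
      simp only [G₁]
      split_ifs
      · exact (D.bell_povm i j μ x).1 a
      · exact cutLocal_posSemidef D μ i
    have hG₂ : ∀ x a i, (G₂ x a i).PosSemidef := fun x a i => by
      simp only [G₂]
      split_ifs
      · exact (D.bell_povm i j μ x).1 a
      · exact cutLocal_posSemidef D μ i
    let T₁ : ((i : ZMod N) → Matrix (Fin (d i)) (Fin (d i)) ℂ) → ℂ := fun E =>
      (ρ₁ * piOp (d := fun i : {i // i ∈ g} => d i) fun i => E i).trace
    let T₂ : ((i : ZMod N) → Matrix (Fin (d i)) (Fin (d i)) ℂ) → ℂ := fun E =>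
      (ρ₂ * piOp (d := fun i : {i // i ∉ g} => d i) fun i => E i).trace
    have pos₁ : ∀ {E}, (∀ i, (E i).PosSemidef) → 0 ≤ T₁ E := fun hE =>
      trace_mul_nonneg_of_posSemidef h₁.1 (piOp_posSemidef fun i => hE i)
    have pos₂ : ∀ {E}, (∀ i, (E i).PosSemidef) → 0 ≤ T₂ E := fun hE =>
      trace_mul_nonneg_of_posSemidef h₂.1 (piOp_posSemidef fun i => hE i)
    have re_mul : ∀ {z w : ℂ}, 0 ≤ z → (z * w).re = z.re * w.re := fun hz => by
      rw [Complex.mul_re, ← (Complex.le_def.mp hz).2, Complex.zero_im, zero_mul, sub_zero]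
    have hjoint : ∀ x y a b, jointProb D ρ j μ x y a b = (T₁ (G₁ x a)).re * (T₂ (G₂ y b)).re := by
      intro x y a b
      rw [← re_mul (pos₁ (hG₁ x a))]
      have := trace_mul_piOp_of_product h fun i => if i = j then D.bell i j μ x a
        else if i = j + 1 then D.bell i j μ y b else cutLocal D μ i
      refine (congrArg Complex.re this).trans ?_
      congr 3
      · congr 2
        funext i
        have : (i : ZMod N) ≠ j + 1 := fun e => hj' (e ▸ i.2)
        simp [G₁, this]
      · congr 2
        funext i
        have : (i : ZMod N) ≠ j := fun e => i.2 (e ▸ hj)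
        simp [G₂, this]
    have hw : cutWeight D ρ μ = (T₁ (cutLocal D μ)).re * (T₂ (cutLocal D μ)).re := by
      rw [← re_mul (pos₁ (cutLocal_posSemidef D μ))]
      exact congrArg Complex.re (trace_mul_piOp_of_product h _)
    -- Summing over the outcomes of a Bell measurement leaves only the cutting operator, so the
    -- total mass does not depend on the setting.
    have sum₁ : ∀ x, ∑ a, (T₁ (G₁ x a)).re = (T₁ (cutLocal D μ)).re := fun x => by
      rw [← Complex.re_sum, ← Matrix.trace_sum, ← Matrix.mul_sum]
      congr 3
      refine sum_piOp_of_eq_off ⟨j, hj⟩ (fun a i hi => ?_) ?_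
      · have : (i : ZMod N) ≠ j := fun e => hi (Subtype.ext e)
        simp [G₁, this]
      · rw [cutLocal_of_notMem D μ (self_notMem_blocks hN j)]
        simpa [G₁] using (D.bell_povm j j μ x).2
    have sum₂ : ∀ y, ∑ b, (T₂ (G₂ y b)).re = (T₂ (cutLocal D μ)).re := fun y => by
      rw [← Complex.re_sum, ← Matrix.trace_sum, ← Matrix.mul_sum]
      congr 3
      refine sum_piOp_of_eq_off ⟨j + 1, hj'⟩ (fun a i hi => ?_) ?_
      · have : (i : ZMod N) ≠ j + 1 := fun e => hi (Subtype.ext e)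
        simp [G₂, this]
      · rw [cutLocal_of_notMem D μ (add_one_notMem_blocks hN j)]
        simpa [G₂] using (D.bell_povm (j + 1) j μ y).2
    simp only [hc, hjoint]
    refine (sum_tiltedCoeff_mul_le hα hr (u := fun x a => (T₁ (G₁ x a)).re)
      (v := fun y b => (T₂ (G₂ y b)).re) (fun x a => (Complex.le_def.mp (pos₁ (hG₁ x a))).1)
      (fun y b => (Complex.le_def.mp (pos₂ (hG₂ y b))).1) sum₁ sum₂).trans ?_
    rw [← hw]
    exact mul_le_mul_of_nonneg_right hβ' (cutWeight_nonneg D hdens μ)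
  calc pairValue c D ρ j ≤ ∑ μ : Branch j n, β * cutWeight D ρ μ :=
        Finset.sum_le_sum fun μ _ => hbranch μ
    _ = β := by rw [← Finset.mul_sum, sum_cutWeight D hdens, mul_one]

/-- Linearity in the state is what reduces biseparable mixtures to products across a single
splitting. -/
theorem bellValue_linear (c : BellCoeff N n) (D : Devices N n d) :
    IsLinearMap ℝ (bellValue c D) := by
  have hadd : ∀ ρ σ j μ x y a b, jointProb D (ρ + σ) j μ x y a b =
      jointProb D ρ j μ x y a b + jointProb D σ j μ x y a b := fun ρ σ j μ x y a b => by
    simp only [jointProb, add_mul, Matrix.trace_add, Complex.add_re]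
  have hsmul : ∀ (t : ℝ) ρ j μ x y a b, jointProb D (t • ρ) j μ x y a b =
      t * jointProb D ρ j μ x y a b := fun t ρ j μ x y a b => by
    simp only [jointProb, smul_mul_assoc, Matrix.trace_smul, Complex.smul_re, smul_eq_mul]
  constructor
  · intro ρ σ
    simp only [bellValue, pairValue, hadd, mul_add, Finset.sum_add_distrib]
  · intro t ρ
    simp only [bellValue, pairValue, hsmul, smul_eq_mul, Finset.mul_sum]
    simp only [mul_left_comm t]

/-- The bound on the Bell value of biseparable states. -/
theorem bellValue_le_of_biseparable (hN : 2 * n + 2 ≤ N) {β : ℝ} (hβ : 0 ≤ β) {c : BellCoeff N n}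
    (hc : ∀ j μ, IsTiltedOrZero β (c j μ)) (D : Devices N n d)
    {ρ : Matrix ((i : ZMod N) → Fin (d i)) ((i : ZMod N) → Fin (d i)) ℂ} (hρ : IsBiseparable ρ) :
    bellValue c D ρ ≤ (N - 1) * 20 + β := by
  have hconv : Convex ℝ {σ | bellValue c D σ ≤ (N - 1) * 20 + β} :=
    convex_halfSpace_le (bellValue_linear c D) _
  refine convexHull_min ?_ hconv hρ
  rintro σ ⟨g, hg, hg', hσ⟩
  -- The pair at the boundary of `g` obeys the local bound; the other N - 1 pairs are only held to
  -- the quantum bound.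
  obtain ⟨j, hj, hj'⟩ := exists_mem_add_one_notMem hg hg'
  have h1 := pairValue_le_of_product hN hβ hc D hσ hj hj'
  have h2 : ∑ i ∈ Finset.univ.erase j, pairValue c D σ i ≤ (N - 1) * 20 := by
    refine (Finset.sum_le_card_nsmul _ _ 20 fun i _ => pairValue_le hN hc D hσ.isDensity i).trans ?_
    rw [Finset.card_erase_of_mem (Finset.mem_univ j), Finset.card_univ, ZMod.card, nsmul_eq_mul,
      Nat.cast_sub (by omega), Nat.cast_one]
  change ∑ i, pairValue c D σ i ≤ _
  rw [← Finset.add_sum_erase _ _ (Finset.mem_univ j)]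
  linarith

end Bounds

/-! ### Closed paths and ordered products -/

section SeqProd

variable {m R : Type*} [Fintype m] [DecidableEq m] [CommSemiring R]

/-- The ordered product `M 0 * M 1 * ⋯ * M (n - 1)`. -/
def seqProd (M : ℕ → Matrix m m R) : ℕ → Matrix m m R
  | 0 => 1
  | n + 1 => seqProd M n * M n

theorem seqProd_add (M : ℕ → Matrix m m R) (a b : ℕ) :
    seqProd M (a + b) = seqProd M a * seqProd (fun k => M (a + k)) b := by
  induction b with
  | zero => simp [seqProd]
  | succ b ih => rw [← add_assoc, seqProd, ih, seqProd, mul_assoc]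

theorem seqProd_congr {M M' : ℕ → Matrix m m R} {n : ℕ} (h : ∀ k < n, M k = M' k) :
    seqProd M n = seqProd M' n := by
  induction n with
  | zero => rfl
  | succ n ih => rw [seqProd, seqProd, ih fun k hk => h k (by omega), h n (by omega)]

/-- The weight `F` of the two endpoints is arbitrary so that the induction can absorb the last
matrix into it. Taking the remaining matrix of the ring as `F` closes the path. -/
theorem sum_path_eq_seqProd (n : ℕ) (M : ℕ → Matrix m m R) (F : m → m → R) :
    ∑ l : Fin (n + 1) → m, (∏ k : Fin n, M k (l k.castSucc) (l k.succ)) *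
      F (l (Fin.last n)) (l 0) = ∑ a, ∑ b, seqProd M n a b * F b a := by
  induction n generalizing F with
  | zero =>
    rw [← (Equiv.funUnique (Fin 1) m).symm.sum_comp]
    simp [seqProd, Matrix.one_apply]
  | succ n ih =>
    rw [← (Fin.snocEquiv fun _ => m).sum_comp, Fintype.sum_prod_type, Finset.sum_comm]
    have h : ∀ l : Fin (n + 1) → m, ∑ x : m,
        (∏ k : Fin (n + 1), M k (Fin.snocEquiv (fun _ => m) (x, l) k.castSucc)
          (Fin.snocEquiv (fun _ => m) (x, l) k.succ)) *
          F (Fin.snocEquiv (fun _ => m) (x, l) (Fin.last (n + 1)))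
            (Fin.snocEquiv (fun _ => m) (x, l) 0) =
        (∏ k : Fin n, M k (l k.castSucc) (l k.succ)) *
          (fun b a => ∑ x, M n b x * F x a) (l (Fin.last n)) (l 0) := by
      intro l
      rw [Finset.mul_sum]
      refine Finset.sum_congr rfl fun x _ => ?_
      rw [Fin.prod_univ_castSucc]
      have h0 : (Fin.snocEquiv (fun _ => m) (x, l) : Fin (n + 2) → m) 0 = l 0 := by
        rw [← Fin.castSucc_zero]
        simp [Fin.snocEquiv]
      rw [h0]
      simp only [Fin.snocEquiv, Equiv.coe_fn_mk, Fin.snoc_castSucc, Fin.succ_last, Fin.snoc_last,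
        ← Fin.castSucc_succ, Fin.val_castSucc, Fin.val_last]
      ring
    refine (Finset.sum_congr rfl fun l _ => h l).trans
      ((ih fun b a => ∑ x, M n b x * F x a).trans ?_)
    refine Finset.sum_congr rfl fun a _ => ?_
    simp only [seqProd, Matrix.mul_apply, Finset.sum_mul, Finset.mul_sum]
    rw [Finset.sum_comm]
    simp only [mul_assoc]

open Fin.NatCast in
theorem sum_closed_path_fin (n : ℕ) (M : Fin (n + 1) → Matrix m m R) :
    ∑ l : Fin (n + 1) → m, ∏ i, M i (l i) (l (i + 1)) =
      (seqProd (fun k => M (k : Fin (n + 1))) (n + 1)).trace := by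
  have h2 : ∀ l : Fin (n + 1) → m, ∏ i, M i (l i) (l (i + 1)) =
      (∏ k : Fin n, M ((k : ℕ) : Fin (n + 1)) (l k.castSucc) (l k.succ)) *
        M (n : Fin (n + 1)) (l (Fin.last n)) (l 0) := by
    intro l
    rw [Fin.prod_univ_castSucc]
    congr 1
    · refine Finset.prod_congr rfl fun k _ => ?_
      rw [Fin.coeSucc_eq_succ, ← Fin.val_castSucc, Fin.cast_val_eq_self]
    · have : (n : Fin (n + 1)) = Fin.last n := Fin.cast_val_eq_self (Fin.last n)
      rw [Fin.last_add_one, this]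
  rw [Finset.sum_congr rfl fun l _ => h2 l,
    sum_path_eq_seqProd n (fun k => M (k : Fin (n + 1))) (M (n : Fin (n + 1)))]
  simp only [seqProd, Matrix.trace, Matrix.diag_apply, Matrix.mul_apply]

/-- The sum over closed paths on the ring is the trace of the ordered product. -/
theorem sum_closed_path {N : ℕ} [NeZero N] (M : ZMod N → Matrix m m R) (j : ZMod N) :
    ∑ l : ZMod N → m, ∏ i, M i (l i) (l (i + 1)) =
      (seqProd (fun k => M (j + (k : ZMod N))) N).trace := by
  have h1 : ∑ l : ZMod N → m, ∏ i, M i (l i) (l (i + 1)) =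
      ∑ l : ZMod N → m, ∏ i, M (j + i) (l i) (l (i + 1)) := by
    rw [← (Equiv.arrowCongr (Equiv.addLeft j) (Equiv.refl m)).sum_comp]
    refine Finset.sum_congr rfl fun l _ => ?_
    rw [← Equiv.prod_comp (Equiv.addLeft j)]
    refine Finset.prod_congr rfl fun i _ => ?_
    simp [Equiv.arrowCongr, add_assoc]
  rw [h1]
  -- `ZMod (n + 1)` is `Fin (n + 1)` by definition.
  obtain ⟨n, rfl⟩ := Nat.exists_eq_succ_of_ne_zero (NeZero.ne N)
  exact sum_closed_path_fin n fun i : ZMod n.succ => M (j + i)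

end SeqProd

/-! ### The AKLT state as a matrix product state -/

section MPS

/-- The matrices of the AKLT state. -/
noncomputable def mpsMat : Fin 3 → Matrix (Fin 2) (Fin 2) ℝ :=
  ![!![0, (√2)⁻¹; 0, 0], !![0, 0; -(√2)⁻¹, 0], !![-1 / 2, 0; 0, 1 / 2]]

theorem inv_sqrt_two_mul_self : (√2 : ℝ)⁻¹ * (√2)⁻¹ = 1 / 2 := by
  rw [← mul_inv, Real.mul_self_sqrt (by norm_num)]
  norm_num

theorem inv_sqrt_two_mul_self_complex : ((√2 : ℝ) : ℂ)⁻¹ * ((√2 : ℝ) : ℂ)⁻¹ = 1 / 2 := by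
  rw [← Complex.ofReal_inv, ← Complex.ofReal_mul, inv_sqrt_two_mul_self]
  norm_num

/-- Absorbing the singlet to the right of a site into that site leaves one sum over the left virtual
qubits, which is the matrix product form. -/
theorem sum_tripletBasis_mul_singlet (a : Fin 3) (l l' : Fin 2) :
    ∑ r, star (tripletBasis a l r) * singlet r l' = (mpsMat a l l' : ℂ) := by
  have h := inv_sqrt_two_mul_self_complex
  fin_cases a <;> fin_cases l <;> fin_cases l' <;>
    simp [tripletBasis, singlet, mpsMat, Fin.sum_univ_two, h, Complex.conj_ofReal] ; norm_num

/-- Up to the factor 4ᴺ this is the squared norm of the unnormalized state. It vanishes for N = 1.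
-/
theorem three_pow_add_pos {N : ℕ} (hN : 2 ≤ N) : 0 < (3 : ℝ) ^ N + 3 * (-1) ^ N := by
  have h9 : (3 : ℝ) ^ 2 ≤ 3 ^ N := pow_le_pow_right₀ (by norm_num) hN
  rcases neg_one_pow_eq_or ℝ N with h | h <;> rw [h] <;> linarith

variable {N : ℕ} [NeZero N]

/-- The amplitudes of the unnormalized AKLT state. -/
noncomputable def mpsAmp (s : ZMod N → Fin 3) : ℝ :=
  ∑ l : ZMod N → Fin 2, ∏ i, mpsMat (s i) (l i) (l (i + 1))

theorem mpsAmp_eq_trace (s : ZMod N → Fin 3) (j : ZMod N) :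
    mpsAmp s = (seqProd (fun k => mpsMat (s (j + (k : ZMod N)))) N).trace :=
  sum_closed_path (fun i => mpsMat (s i)) j

theorem sum_virtual_eq_mpsAmp (s : ZMod N → Fin 3) :
    ∑ l : ZMod N → Fin 2, ∑ r : ZMod N → Fin 2,
      (∏ i, star (tripletBasis (s i) (l i) (r i))) * ∏ i, singlet (r i) (l (i + 1)) =
    (mpsAmp s : ℂ) := by
  rw [mpsAmp, Complex.ofReal_sum]
  refine Finset.sum_congr rfl fun l _ => ?_
  rw [Complex.ofReal_prod]
  simp only [← sum_tripletBasis_mul_singlet, ← Finset.prod_mul_distrib]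
  rw [Finset.prod_univ_sum, Fintype.piFinset_univ]

/-- The squared norm of the unnormalized AKLT state. -/
noncomputable def mpsNormSq (N : ℕ) [NeZero N] : ℝ := ∑ s : ZMod N → Fin 3, mpsAmp s ^ 2

theorem akltState_apply (s : ZMod N → Fin 3) :
    akltState N s = (((√(mpsNormSq N))⁻¹ * mpsAmp s : ℝ) : ℂ) := by
  have h : akltState N = unitVec (WithLp.toLp 2 fun s : ZMod N → Fin 3 => (mpsAmp s : ℂ)) := by
    rw [akltState]
    congr 2
    funext s
    exact sum_virtual_eq_mpsAmp s
  rw [h, unitVec, EuclideanSpace.norm_eq]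
  simp [mpsNormSq]

theorem norm_akltState_sq (s : ZMod N → Fin 3) :
    ‖akltState N s‖ ^ 2 = mpsAmp s ^ 2 / mpsNormSq N := by
  rw [akltState_apply, Complex.norm_real, Real.norm_eq_abs, sq_abs, mul_pow, inv_pow,
    Real.sq_sqrt (show 0 ≤ mpsNormSq N from Finset.sum_nonneg fun s _ => sq_nonneg _)]
  ring

/-- The transfer matrix, with weights for the states of the spin. -/
noncomputable def transferMat (w : Fin 3 → ℝ) : Matrix (Fin 2 × Fin 2) (Fin 2 × Fin 2) ℝ :=
  Matrix.of fun p q => ∑ a, w a * (mpsMat a p.1 q.1 * mpsMat a p.2 q.2)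

/-- A squared amplitude is a double sum over closed paths, that is, a sum over closed paths of pairs
of virtual indices. As the weight is a product over the sites, each spin can be summed inside its
own factor. -/
theorem sum_weight_mul_mpsAmp_sq (w : ZMod N → Fin 3 → ℝ) (j : ZMod N) :
    ∑ s : ZMod N → Fin 3, (∏ i, w i (s i)) * mpsAmp s ^ 2 =
      (seqProd (fun k => transferMat (w (j + (k : ZMod N)))) N).trace := by
  rw [← sum_closed_path (fun i => transferMat (w i)) j,
    ← (Equiv.arrowProdEquivProdArrow (ZMod N) (fun _ => Fin 2) (fun _ => Fin 2)).symm.sum_comp,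
    Fintype.sum_prod_type]
  have hsq : ∀ s : ZMod N → Fin 3, mpsAmp s ^ 2 = ∑ l : ZMod N → Fin 2, ∑ l' : ZMod N → Fin 2,
      (∏ i, mpsMat (s i) (l i) (l (i + 1))) * ∏ i, mpsMat (s i) (l' i) (l' (i + 1)) := fun s => by
    rw [mpsAmp, sq, Finset.sum_mul_sum]
  simp only [hsq, Finset.mul_sum]
  rw [Finset.sum_comm]
  refine Finset.sum_congr rfl fun l _ => ?_
  rw [Finset.sum_comm]
  refine Finset.sum_congr rfl fun l' _ => ?_
  simp only [← Finset.prod_mul_distrib, transferMat, Matrix.of_apply]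
  rw [Finset.prod_univ_sum, Fintype.piFinset_univ]
  rfl

/-- The matrices that commute with all the symmetries of the transfer matrix: `x` and `y` are the
eigenvalues on the even and the odd combination of `(0, 0)` and `(1, 1)`, and `z` is the eigenvalue
on `(0, 1)` and `(1, 0)`. -/
noncomputable def modeMat (x y z : ℝ) : Matrix (Fin 2 × Fin 2) (Fin 2 × Fin 2) ℝ :=
  Matrix.of fun p q => if p = q then (if p.1 = p.2 then (x + y) / 2 else z)
    else if p.1 = p.2 ∧ q.1 = q.2 then (x - y) / 2 else 0

theorem modeMat_mul (x y z x' y' z' : ℝ) :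
    modeMat x y z * modeMat x' y' z' = modeMat (x * x') (y * y') (z * z') := by
  ext ⟨a, b⟩ ⟨c, d⟩
  rw [Matrix.mul_apply, Fintype.sum_prod_type]
  simp only [modeMat, Matrix.of_apply, Fin.sum_univ_two]
  fin_cases a <;> fin_cases b <;> fin_cases c <;> fin_cases d <;> simp <;> ring

theorem modeMat_one : modeMat 1 1 1 = 1 := by
  ext p q
  by_cases h : p = q
  · subst h; simp [modeMat]
  · simp [modeMat, h, Matrix.one_apply_ne h]

theorem trace_modeMat (x y z : ℝ) : (modeMat x y z).trace = x + y + 2 * z := by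
  simp [modeMat, Matrix.trace, Fintype.sum_prod_type, Fin.sum_univ_two]
  ring

theorem seqProd_modeMat (x y z : ℕ → ℝ) (n : ℕ) :
    seqProd (fun k => modeMat (x k) (y k) (z k)) n =
      modeMat (∏ k ∈ Finset.range n, x k) (∏ k ∈ Finset.range n, y k)
        (∏ k ∈ Finset.range n, z k) := by
  induction n with
  | zero => simp [seqProd, modeMat_one]
  | succ n ih => simp only [seqProd, ih, modeMat_mul, Finset.prod_range_succ]

theorem transferMat_one : transferMat (fun _ => 1) = modeMat (3 / 4) (-1 / 4) (-1 / 4) := by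
  have h := inv_sqrt_two_mul_self
  ext ⟨a, b⟩ ⟨c, d⟩
  fin_cases a <;> fin_cases b <;> fin_cases c <;> fin_cases d <;>
    simp [transferMat, modeMat, mpsMat, Fin.sum_univ_three, h] <;> norm_num

/-- Conditioning on 2̃ stays within the commuting family `modeMat`; hence only the number of
conditioned sites matters, not their positions. -/
theorem transferMat_two :
    transferMat (fun a => if a = 2 then 1 else 0) = modeMat (1 / 4) (1 / 4) (-1 / 4) := by
  ext ⟨a, b⟩ ⟨c, d⟩
  fin_cases a <;> fin_cases b <;> fin_cases c <;> fin_cases d <;>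
    simp [transferMat, modeMat, mpsMat] <;> norm_num

theorem prod_range_zmod {M : Type*} [CommMonoid M] (x : ZMod N → M) :
    ∏ k ∈ Finset.range N, x (k : ZMod N) = ∏ i, x i := by
  obtain ⟨N', rfl⟩ := Nat.exists_eq_succ_of_ne_zero (NeZero.ne N)
  rw [Finset.prod_range]
  exact Fintype.prod_congr _ _ fun i : Fin (N' + 1) => congrArg x (Fin.cast_val_eq_self i)

theorem prod_ite_mem_const (S : Finset (ZMod N)) (a b : ℝ) :
    ∏ i, (if i ∈ S then a else b) = a ^ S.card * b ^ (N - S.card) := by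
  rw [Finset.prod_ite, Finset.prod_const, Finset.prod_const, Finset.filter_mem_eq_inter,
    Finset.univ_inter, Finset.filter_not, Finset.filter_mem_eq_inter, Finset.univ_inter,
    ← Finset.compl_eq_univ_sdiff, Finset.card_compl, ZMod.card]

/-- The weight of the configurations that have the outcome `2̃` on a given set of sites. -/
theorem sum_mpsAmp_sq_two_on (S : Finset (ZMod N)) :
    ∑ s : ZMod N → Fin 3, (if ∀ i ∈ S, s i = 2 then mpsAmp s ^ 2 else 0) =
      (1 / 4) ^ S.card * (3 / 4) ^ (N - S.card) + (1 / 4) ^ S.card * (-1 / 4) ^ (N - S.card) +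
        2 * (-1 / 4) ^ N := by
  let w : ZMod N → Fin 3 → ℝ := fun i a => if i ∈ S then (if a = 2 then 1 else 0) else 1
  have h1 : ∀ s : ZMod N → Fin 3, (if ∀ i ∈ S, s i = 2 then mpsAmp s ^ 2 else 0) =
      (∏ i, w i (s i)) * mpsAmp s ^ 2 := by
    intro s
    split_ifs with h
    · rw [Finset.prod_eq_one, one_mul]
      intro i _
      by_cases hi : i ∈ S
      · simp [w, hi, h i hi]
      · simp [w, hi]
    · push Not at h
      obtain ⟨i, hi, h⟩ := h
      rw [Finset.prod_eq_zero (Finset.mem_univ i) (by simp [w, hi, h]), zero_mul]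
  have h2 : ∀ i, transferMat (w i) = modeMat (if i ∈ S then 1 / 4 else 3 / 4)
      (if i ∈ S then 1 / 4 else -1 / 4) (-1 / 4) := by
    intro i
    by_cases hi : i ∈ S
    · simp only [w, hi, if_true]; exact transferMat_two
    · simp only [w, hi, if_false]; exact transferMat_one
  rw [Finset.sum_congr rfl fun s _ => h1 s, sum_weight_mul_mpsAmp_sq w 0]
  simp only [h2, zero_add]
  rw [seqProd_modeMat (fun k => if (k : ZMod N) ∈ S then 1 / 4 else 3 / 4)
    (fun k => if (k : ZMod N) ∈ S then 1 / 4 else -1 / 4), trace_modeMat,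
    prod_range_zmod (fun i => if i ∈ S then (1 / 4 : ℝ) else 3 / 4),
    prod_range_zmod (fun i => if i ∈ S then (1 / 4 : ℝ) else -1 / 4),
    prod_ite_mem_const, prod_ite_mem_const, Finset.prod_const, Finset.card_range]

theorem mpsNormSq_eq : mpsNormSq N = (3 / 4) ^ N + 3 * (-1 / 4) ^ N := by
  have := sum_mpsAmp_sq_two_on (N := N) ∅
  simp only [Finset.notMem_empty, false_imp_iff, implies_true, if_true, Finset.card_empty,
    pow_zero, one_mul, Nat.sub_zero] at this
  rw [mpsNormSq, this]
  ring

theorem div_four_pow (a : ℝ) (k : ℕ) : (a / 4) ^ k = (1 / 4) ^ k * a ^ k := by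
  rw [← mul_pow]
  congr 1
  ring

theorem mpsNormSq_pos (hN : 2 ≤ N) : 0 < mpsNormSq N := by
  rw [mpsNormSq_eq, div_four_pow 3, div_four_pow (-1)]
  have := mul_pos (show (0 : ℝ) < (1 / 4) ^ N by positivity) (three_pow_add_pos hN)
  linarith

theorem norm_akltState (hN : 2 ≤ N) : ‖akltState N‖ = 1 := by
  have h := mpsNormSq_pos hN
  rw [EuclideanSpace.norm_eq]
  simp only [norm_akltState_sq]
  rw [← Finset.sum_div]
  change √(mpsNormSq N / mpsNormSq N) = 1
  rw [div_self h.ne', Real.sqrt_one]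

/-- The probability of the outcome `2̃` on a given set of sites. -/
theorem prob_two_on (hN : 2 ≤ N) (S : Finset (ZMod N)) :
    ∑ s : ZMod N → Fin 3, (if ∀ i ∈ S, s i = 2 then ‖akltState N s‖ ^ 2 else 0) =
      (3 ^ (N - S.card) + (-1) ^ (N - S.card) + 2 * (-1) ^ N) / (3 ^ N + 3 * (-1) ^ N) := by
  have h : ∀ s : ZMod N → Fin 3, (if ∀ i ∈ S, s i = 2 then ‖akltState N s‖ ^ 2 else 0) =
      (if ∀ i ∈ S, s i = 2 then mpsAmp s ^ 2 else 0) / mpsNormSq N := fun s => by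
    split_ifs
    · exact norm_akltState_sq s
    · simp
  have hS : S.card ≤ N := by simpa [ZMod.card] using S.card_le_univ
  have h4 : ((1 : ℝ) / 4) ^ S.card * (1 / 4) ^ (N - S.card) = (1 / 4) ^ N := by
    rw [← pow_add, Nat.add_sub_cancel' hS]
  rw [Finset.sum_congr rfl fun s _ => h s, ← Finset.sum_div, sum_mpsAmp_sq_two_on, mpsNormSq_eq,
    div_four_pow 3, div_four_pow (-1), div_four_pow 3, div_four_pow (-1), ← mul_assoc, ← mul_assoc,
    h4]
  have hp := three_pow_add_pos hN
  have hq : (0 : ℝ) < (1 / 4) ^ N := by positivity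
  rw [div_eq_div_iff (by nlinarith) hp.ne']
  ring

/-- Flipping the physical and virtual spins together is a symmetry up to one sign per site. It makes
0̃ and 1̃ equally likely. -/
theorem mpsMat_swap (a : Fin 3) (l l' : Fin 2) :
    mpsMat (Equiv.swap 0 1 a) (Equiv.swap 0 1 l) (Equiv.swap 0 1 l') = -1 * mpsMat a l l' := by
  have h2 : (Equiv.swap (0 : Fin 3) 1) 2 = 2 := by decide
  fin_cases a <;> fin_cases l <;> fin_cases l' <;> simp [mpsMat, h2] <;> norm_num

theorem mpsAmp_swap (s : ZMod N → Fin 3) :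
    mpsAmp (fun i => Equiv.swap 0 1 (s i)) = (-1) ^ N * mpsAmp s := by
  rw [mpsAmp, mpsAmp, Finset.mul_sum,
    ← (Equiv.arrowCongr (Equiv.refl (ZMod N)) (Equiv.swap (0 : Fin 2) 1)).sum_comp]
  refine Finset.sum_congr rfl fun l _ => ?_
  simp only [Equiv.arrowCongr_apply, Equiv.coe_refl, Equiv.refl_symm, Function.comp_apply, id_eq,
    mpsMat_swap, Finset.prod_mul_distrib, Finset.prod_const, Finset.card_univ, ZMod.card]

/-- The outcomes of a measurement of one site are uniformly random. -/
theorem prob_site (hN : 2 ≤ N) (i : ZMod N) (o : Fin 3) :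
    (∑ s : ZMod N → Fin 3, if s i = o then ‖akltState N s‖ ^ 2 else 0) = 1 / 3 := by
  let P : Fin 3 → ℝ := fun o => ∑ s : ZMod N → Fin 3, if s i = o then ‖akltState N s‖ ^ 2 else 0
  have hp := three_pow_add_pos hN
  have h2 : P 2 = 1 / 3 := by
    have := prob_two_on hN {i}
    simp only [Finset.mem_singleton, forall_eq, Finset.card_singleton] at this
    change P 2 = _ at this
    rw [this, div_eq_div_iff hp.ne' (by norm_num)]
    obtain ⟨M, rfl⟩ : ∃ M, N = M + 1 := ⟨N - 1, by omega⟩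
    rw [Nat.add_sub_cancel, pow_succ, pow_succ]
    ring
  have h01 : P 0 = P 1 := by
    simp only [P]
    rw [← (Equiv.arrowCongr (Equiv.refl (ZMod N)) (Equiv.swap (0 : Fin 3) 1)).sum_comp]
    refine Finset.sum_congr rfl fun s _ => ?_
    have h := mpsAmp_swap s
    have hs : (Equiv.arrowCongr (Equiv.refl (ZMod N)) (Equiv.swap (0 : Fin 3) 1)) s =
        fun i => Equiv.swap 0 1 (s i) := rfl
    rw [hs, norm_akltState_sq, norm_akltState_sq, h, mul_pow, ← pow_mul, mul_comm N 2, pow_mul]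
    simp [Equiv.swap_apply_eq_iff]
  have hsum : P 0 + P 1 + P 2 = 1 := by
    rw [← Fin.sum_univ_three, Finset.sum_comm]
    simp only [Finset.sum_ite_eq, Finset.mem_univ, if_true]
    have := norm_akltState hN
    rw [EuclideanSpace.norm_eq, Real.sqrt_eq_one] at this
    exact this
  have : ∀ o, P o = 1 / 3 := by
    intro o
    fin_cases o
    · change P 0 = 1 / 3; linarith
    · change P 1 = 1 / 3; linarith
    · exact h2
  exact this o

/-! ### The probability of cutting out a pair -/

open Classical in
theorem cutProb_eq {n : ℕ} (ψ : EuclideanSpace ℂ (ZMod N → Fin 3)) (j : ZMod N) :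
    cutProb ψ j n = ∑ s : ZMod N → Fin 3,
      if (∃ i ∈ leftBlock j n, s i ≠ 2) ∧ (∃ i ∈ rightBlock j n, s i ≠ 2)
        then ‖ψ s‖ ^ 2 else 0 := by
  have h1 : ∀ μ : Branch j n, (if IsCut μ then branchProb ψ μ else 0) =
      ∑ s : ZMod N → Fin 3, if (fun i : {i // i ∈ leftBlock j n ∪ rightBlock j n} => s i.1) = μ
        then (if IsCut μ then ‖ψ s‖ ^ 2 else 0) else 0 := by
    intro μ
    split_ifs with h
    · exact Finset.sum_congr rfl fun s _ => by simp only [funext_iff]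
    · simp
  rw [cutProb, Finset.sum_congr rfl fun μ _ => h1 μ, Finset.sum_comm]
  refine Finset.sum_congr rfl fun s _ => ?_
  rw [Finset.sum_ite_eq, if_pos (Finset.mem_univ _)]
  refine if_congr ?_ rfl rfl
  refine and_congr ⟨?_, ?_⟩ ⟨?_, ?_⟩
  · rintro ⟨i, hi, h⟩; exact ⟨i, hi, h⟩
  · rintro ⟨i, hi, h⟩; exact ⟨⟨i, Finset.mem_union_left _ hi⟩, hi, h⟩
  · rintro ⟨i, hi, h⟩; exact ⟨i, hi, h⟩
  · rintro ⟨i, hi, h⟩; exact ⟨⟨i, Finset.mem_union_right _ hi⟩, hi, h⟩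

/-- Inclusion-exclusion over the two events that a block shows 2̃ everywhere. -/
theorem cutProb_akltState {n : ℕ} (hN : 2 * n + 2 ≤ N) (j : ZMod N) :
    cutProb (akltState N) j n = 1 -
      (2 * (3 ^ (N - n) + (-1) ^ (N - n) + 2 * (-1) ^ N) - (3 ^ (N - 2 * n) + 3 * (-1) ^ N)) /
        (3 ^ N + 3 * (-1) ^ N) := by
  classical
  have hN2 : 2 ≤ N := by omega
  have hL := prob_two_on hN2 (leftBlock j n)
  have hR := prob_two_on hN2 (rightBlock j n)
  have hLR := prob_two_on hN2 (leftBlock j n ∪ rightBlock j n)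
  have h1 : ∑ s, ‖akltState N s‖ ^ 2 = 1 := by
    have := norm_akltState hN2
    rwa [EuclideanSpace.norm_eq, Real.sqrt_eq_one] at this
  rw [card_leftBlock hN] at hL
  rw [card_rightBlock hN] at hR
  rw [card_blocks hN] at hLR
  have he : (-1 : ℝ) ^ (N - 2 * n) = (-1) ^ N := by
    conv_rhs => rw [← Nat.sub_add_cancel (show 2 * n ≤ N by omega), pow_add, pow_mul]
    simp
  rw [he] at hLR
  have hsplit : cutProb (akltState N) j n = ∑ s, ‖akltState N s‖ ^ 2 -
      (∑ s : ZMod N → Fin 3, if ∀ i ∈ leftBlock j n, s i = 2 then ‖akltState N s‖ ^ 2 else 0) -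
      (∑ s : ZMod N → Fin 3, if ∀ i ∈ rightBlock j n, s i = 2 then ‖akltState N s‖ ^ 2 else 0) +
      ∑ s : ZMod N → Fin 3, if ∀ i ∈ leftBlock j n ∪ rightBlock j n, s i = 2
        then ‖akltState N s‖ ^ 2 else 0 := by
    rw [cutProb_eq, ← Finset.sum_sub_distrib, ← Finset.sum_sub_distrib, ← Finset.sum_add_distrib]
    refine Finset.sum_congr rfl fun s _ => ?_
    have eL : (∃ i ∈ leftBlock j n, s i ≠ 2) ↔ ¬ ∀ i ∈ leftBlock j n, s i = 2 := by
      push Not; rfl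
    have eR : (∃ i ∈ rightBlock j n, s i ≠ 2) ↔ ¬ ∀ i ∈ rightBlock j n, s i = 2 := by
      push Not; rfl
    simp only [Finset.forall_mem_union, eL, eR]
    split_ifs <;> first | (exfalso; tauto) | ring
  rw [hsplit, h1, hL, hR, hLR]
  ring

theorem cutProb_bounds {n : ℕ} (hn : 1 ≤ n) (hN : 2 * n + 2 ≤ N) (j : ZMod N) :
    1 - 2 * (1 / 3 : ℝ) ^ n ≤ cutProb (akltState N) j n ∧
      cutProb (akltState N) j n ≤ 1 - 2 * (1 / 3 : ℝ) ^ n + 2 * (1 / 9 : ℝ) ^ n := by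
  have hZ := three_pow_add_pos (N := N) (by omega)
  rw [cutProb_akltState hN]
  obtain ⟨m, rfl⟩ : ∃ m, N = 2 * n + 2 + m := ⟨N - (2 * n + 2), by omega⟩
  have hu : (1 : ℝ) ≤ 3 ^ m := one_le_pow₀ (by norm_num)
  have ht : (3 : ℝ) ≤ 3 ^ n := by
    simpa using pow_le_pow_right₀ (show (1 : ℝ) ≤ 3 by norm_num) hn
  have e1 : (3 : ℝ) ^ (2 * n + 2 + m) = 9 * (3 ^ n) ^ 2 * 3 ^ m := by
    rw [pow_add, pow_add, pow_mul']; ring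
  have e2 : (3 : ℝ) ^ (2 * n + 2 + m - n) = 9 * 3 ^ n * 3 ^ m := by
    rw [show 2 * n + 2 + m - n = n + 2 + m by omega, pow_add, pow_add]; ring
  have e3 : (3 : ℝ) ^ (2 * n + 2 + m - 2 * n) = 9 * 3 ^ m := by
    rw [show 2 * n + 2 + m - 2 * n = 2 + m by omega, pow_add]; ring
  have e4 : (1 / 3 : ℝ) ^ n = (3 ^ n)⁻¹ := by rw [one_div, inv_pow]
  have e5 : (1 / 9 : ℝ) ^ n = ((3 ^ n)⁻¹) ^ 2 := by
    rw [← e4, ← pow_mul, mul_comm, pow_mul]; norm_num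
  rw [e1] at hZ
  rw [e1, e2, e3, e4, e5]
  set t : ℝ := 3 ^ n
  set u : ℝ := 3 ^ m
  have ht0 : 0 < t := by linarith
  have hv0 : 0 < t⁻¹ := inv_pos.mpr ht0
  have hv1 : t⁻¹ ≤ 1 / 3 := by rw [inv_eq_one_div]; exact one_div_le_one_div_of_le (by norm_num) ht
  have htv : t * t⁻¹ = 1 := mul_inv_cancel₀ ht0.ne'
  set v := t⁻¹
  have k1 : v * (9 * t ^ 2 * u) = 9 * t * u := by linear_combination 9 * t * u * htv
  have k2 : v ^ 2 * (9 * t ^ 2 * u) = 9 * u := by linear_combination (9 * u) * (t * v + 1) * htv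
  -- Here `v` is 3⁻ⁿ, and up to alternating signs the subtracted fraction is 2v - v². It lies about
  -- v² away from each of the claimed bounds 2v and 2v - 2v². After multiplication by the
  -- denominator this is about 9u, which absorbs the signs in every parity case.
  constructor
  · rw [sub_le_sub_iff_left, div_le_iff₀ hZ, mul_add]
    rcases neg_one_pow_eq_or ℝ (2 * n + 2 + m) with h | h <;>
    rcases neg_one_pow_eq_or ℝ (2 * n + 2 + m - n) with h' | h' <;> rw [h, h'] <;> nlinarith
  · rw [sub_add, sub_le_sub_iff_left, le_div_iff₀ hZ, mul_add, sub_mul, sub_mul]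
    rcases neg_one_pow_eq_or ℝ (2 * n + 2 + m) with h | h <;>
    rcases neg_one_pow_eq_or ℝ (2 * n + 2 + m - n) with h' | h' <;> rw [h, h'] <;> nlinarith

end MPS

/-! ### Two-site operators -/

section PairUpdate

variable {N : ℕ}

/-- Replace the states of the sites `j` and `j + 1`. -/
def pairUpdate (j : ZMod N) (s : ZMod N → Fin 3) (q : Fin 3 × Fin 3) : ZMod N → Fin 3 :=
  Function.update (Function.update s j q.1) (j + 1) q.2

variable {j : ZMod N} (s : ZMod N → Fin 3) (p q : Fin 3 × Fin 3)

theorem pairUpdate_left (hj : j ≠ j + 1) : pairUpdate j s q j = q.1 := by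
  simp [pairUpdate, hj]

theorem pairUpdate_right : pairUpdate j s q (j + 1) = q.2 := by
  simp [pairUpdate]

theorem pairUpdate_of_ne {i : ZMod N} (h : i ≠ j) (h' : i ≠ j + 1) : pairUpdate j s q i = s i := by
  simp [pairUpdate, h, h']

theorem pairUpdate_pairUpdate : pairUpdate j (pairUpdate j s p) q = pairUpdate j s q := by
  funext i
  by_cases h' : i = j + 1
  · subst h'; rw [pairUpdate_right, pairUpdate_right]
  · by_cases h : i = j
    · subst h; simp [pairUpdate, h']
    · simp only [pairUpdate_of_ne _ _ h h']

theorem pairUpdate_self : pairUpdate j s (s j, s (j + 1)) = s := by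
  funext i
  by_cases h' : i = j + 1
  · subst h'; rw [pairUpdate_right]
  · by_cases h : i = j
    · subst h; simp [pairUpdate, h']
    · rw [pairUpdate_of_ne _ _ h h']

end PairUpdate

section LocalAction

variable {N : ℕ} {j : ZMod N}

/-- The action of an operator of two spins on the sites `j` and `j + 1`. -/
def localAction (j : ZMod N) (M : Matrix (Fin 3 × Fin 3) (Fin 3 × Fin 3) ℂ)
    (φ : (ZMod N → Fin 3) → ℂ) (s : ZMod N → Fin 3) : ℂ :=
  ∑ q, M (s j, s (j + 1)) q * φ (pairUpdate j s q)

theorem localAction_mul (hj : j ≠ j + 1) (M M' : Matrix (Fin 3 × Fin 3) (Fin 3 × Fin 3) ℂ)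
    (φ : (ZMod N → Fin 3) → ℂ) :
    localAction j M (localAction j M' φ) = localAction j (M * M') φ := by
  funext s
  simp only [localAction, pairUpdate_left s _ hj, pairUpdate_right, pairUpdate_pairUpdate,
    Matrix.mul_apply, Finset.mul_sum, Finset.sum_mul, mul_assoc]
  exact Finset.sum_comm

theorem localAction_one (φ : (ZMod N → Fin 3) → ℂ) : localAction j 1 φ = φ := by
  funext s
  simp [localAction, Matrix.one_apply, pairUpdate_self]

theorem localAction_add (M M' : Matrix (Fin 3 × Fin 3) (Fin 3 × Fin 3) ℂ)
    (φ : (ZMod N → Fin 3) → ℂ) :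
    localAction j (M + M') φ = localAction j M φ + localAction j M' φ := by
  funext s
  simp [localAction, add_mul, Finset.sum_add_distrib]

theorem localAction_smul (c : ℂ) (M : Matrix (Fin 3 × Fin 3) (Fin 3 × Fin 3) ℂ)
    (φ : (ZMod N → Fin 3) → ℂ) : localAction j (c • M) φ = c • localAction j M φ := by
  funext s
  simp [localAction, Finset.mul_sum, mul_assoc]

variable [NeZero N]

theorem dotProduct_localAction (hj : j ≠ j + 1) (M : Matrix (Fin 3 × Fin 3) (Fin 3 × Fin 3) ℂ)
    (φ χ : (ZMod N → Fin 3) → ℂ) :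
    star φ ⬝ᵥ localAction j M χ = star (localAction j M.conjTranspose φ) ⬝ᵥ χ := by
  simp only [dotProduct, Pi.star_apply, localAction, star_sum, star_mul', Finset.mul_sum,
    Finset.sum_mul, Matrix.conjTranspose_apply, star_star]
  rw [← Fintype.sum_prod_type', ← Fintype.sum_prod_type']
  -- Exchanging the states of the pair in `s` with `q` is an involution of the index set of the
  -- double sum, and it moves the operator to the other side.
  let f : (ZMod N → Fin 3) × (Fin 3 × Fin 3) → (ZMod N → Fin 3) × (Fin 3 × Fin 3) := fun x =>
    (pairUpdate j x.1 x.2, (x.1 j, x.1 (j + 1)))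
  have hf : Function.Involutive f := fun x => by
    simp only [f, pairUpdate_left x.1 _ hj, pairUpdate_right, pairUpdate_pairUpdate,
      pairUpdate_self]
  rw [← Equiv.sum_comp (hf.toPerm f)]
  refine Finset.sum_congr rfl fun x _ => ?_
  simp only [Function.Involutive.coe_toPerm, f, pairUpdate_left x.1 _ hj, pairUpdate_right,
    pairUpdate_pairUpdate, pairUpdate_self]
  ring

theorem piOp_update_mulVec (i : ZMod N) (A : Matrix (Fin 3) (Fin 3) ℂ)
    (φ : (ZMod N → Fin 3) → ℂ) (s : ZMod N → Fin 3) :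
    (siteHom (d := fun _ : ZMod N => 3) i A).mulVec φ s =
      ∑ a, A (s i) a * φ (Function.update s i a) := by
  rw [Matrix.mulVec, dotProduct, siteHom_apply]
  refine (Finset.sum_of_injOn (fun a => Function.update s i a) ?_ (fun _ _ => Finset.mem_coe.mpr
    (Finset.mem_univ _)) ?_ ?_).symm
  · exact (Function.update_injective s i).injOn
  · intro t _ ht
    have : ∃ k, k ≠ i ∧ s k ≠ t k := by
      by_contra! h
      refine ht ⟨t i, by simp, ?_⟩
      funext k
      by_cases hk : k = i
      · subst hk; simp
      · simp [hk, h k hk]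
    obtain ⟨k, hk, hst⟩ := this
    rw [piOp, Matrix.of_apply, Finset.prod_eq_zero (Finset.mem_univ k), zero_mul]
    simp [hk, hst]
  · intro a _
    rw [piOp, Matrix.of_apply, ← Finset.mul_prod_erase _ _ (Finset.mem_univ i),
      Finset.prod_eq_one, mul_one, Function.update_self, Function.update_self]
    intro k hk
    have hk := Finset.ne_of_mem_erase hk
    simp [hk]

theorem siteOp_eq_siteHom (i : ZMod N) (A : Matrix (Fin 3) (Fin 3) ℂ) :
    siteOp i A = siteHom (d := fun _ : ZMod N => 3) i A := by
  rw [siteHom_apply]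
  refine congrArg piOp (funext fun k => ?_)
  by_cases h : k = i
  · subst h; simp
  · simp [h]

theorem siteHom_mul_siteHom_mulVec (hj : j ≠ j + 1) (A B : Matrix (Fin 3) (Fin 3) ℂ)
    (φ : (ZMod N → Fin 3) → ℂ) :
    (siteHom (d := fun _ : ZMod N => 3) j A * siteHom (d := fun _ : ZMod N => 3) (j + 1) B).mulVec φ
      = localAction j (Matrix.of fun p q => A p.1 q.1 * B p.2 q.2) φ := by
  funext s
  rw [← Matrix.mulVec_mulVec, piOp_update_mulVec]
  simp only [piOp_update_mulVec, localAction, Fintype.sum_prod_type, Matrix.of_apply,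
    Function.update_of_ne hj.symm, Finset.mul_sum, mul_assoc]
  rfl

end LocalAction

/-! ### The AKLT state is a ground state -/

/-- The Heisenberg coupling of two spins. -/
def coupling : Matrix (Fin 3 × Fin 3) (Fin 3 × Fin 3) ℤ :=
  Matrix.of fun p q =>
    if p = q then (![![1, -1, 0], ![-1, 1, 0], ![0, 0, 0]] : Matrix (Fin 3) (Fin 3) ℤ) p.1 p.2
    else if (p, q) ∈ ([((0, 2), (2, 0)), ((2, 0), (0, 2)), ((1, 2), (2, 1)), ((2, 1), (1, 2)),
      ((2, 2), (0, 1)), ((2, 2), (1, 0)), ((0, 1), (2, 2)), ((1, 0), (2, 2))] :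
        List ((Fin 3 × Fin 3) × (Fin 3 × Fin 3))) then 1 else 0

/-- In this basis the coupling has integer entries, so the operator identities that follow can be
decided by evaluation over ℤ. -/
theorem coupling_eq : (Matrix.of fun p q => ∑ α, spinOne α p.1 q.1 * spinOne α p.2 q.2) =
    coupling.map (Int.cast : ℤ → ℂ) := by
  have h : ((√2 : ℝ) : ℂ) ^ 2 = 2 := by
    rw [← Complex.ofReal_pow, Real.sq_sqrt (by norm_num)]
    norm_num
  ext ⟨a, b⟩ ⟨c, d⟩
  fin_cases a <;> fin_cases b <;> fin_cases c <;> fin_cases d <;>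
    simp [coupling, spinOne, Fin.sum_univ_three] <;> ring_nf <;> simp [h, Complex.I_sq] <;> norm_num

/-- Unnormalized vectors of total spin two. -/
def spinTwoVec : Fin 5 → Matrix (Fin 3) (Fin 3) ℤ :=
  ![!![1, 0, 0; 0, 0, 0; 0, 0, 0], !![0, 0, 0; 0, 1, 0; 0, 0, 0], !![0, 0, 1; 0, 0, 0; 1, 0, 0],
    !![0, 0, 0; 0, 0, 1; 0, 1, 0], !![0, 1, 0; 1, 0, 0; 0, 0, 2]]

/-- Six times the projection onto total spin two. -/
def spinTwoProj : Matrix (Fin 3 × Fin 3) (Fin 3 × Fin 3) ℤ :=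
  Matrix.of fun p q => ∑ m, (![6, 6, 3, 3, 1] : Fin 5 → ℤ) m *
    (spinTwoVec m p.1 p.2 * spinTwoVec m q.1 q.2)

/-- The coupling is 1, -1, -2 on total spin 2, 1, 0, where x² + 3x takes the values 4, -2, -2. -/
theorem coupling_quadratic : coupling * coupling + 3 * coupling = spinTwoProj - 2 := by
  decide +kernel

/-- The weights 6, 6, 3, 3, 1 are 6 divided by the squared lengths 1, 1, 2, 2, 6 of the orthogonal
vectors `spinTwoVec`. -/
theorem spinTwoProj_mul_self : spinTwoProj * spinTwoProj = 6 * spinTwoProj := by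
  decide +kernel

theorem spinTwoProj_transpose : spinTwoProj.transpose = spinTwoProj := by
  decide +kernel

/-- Two of the four virtual qubits of neighbouring sites form a singlet, so the total spin is at
most one. -/
theorem sum_spinTwoVec_mul_mpsMat (m : Fin 5) (a b : Fin 2) :
    ∑ q : Fin 3 × Fin 3, (spinTwoVec m q.1 q.2 : ℝ) * (mpsMat q.1 * mpsMat q.2) a b = 0 := by
  have h := inv_sqrt_two_mul_self
  rw [Fintype.sum_prod_type]
  fin_cases m <;> fin_cases a <;> fin_cases b <;>
    simp [spinTwoVec, mpsMat, Fin.sum_univ_three, Matrix.mul_apply, h] <;>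
    first | (norm_num; done) | ring

theorem sum_spinTwoProj_mul_mpsMat (p : Fin 3 × Fin 3) (a b : Fin 2) :
    ∑ q : Fin 3 × Fin 3, (spinTwoProj p q : ℝ) * (mpsMat q.1 * mpsMat q.2) a b = 0 := by
  simp only [spinTwoProj, Matrix.of_apply, Int.cast_sum, Int.cast_mul, Finset.sum_mul]
  rw [Finset.sum_comm]
  refine Finset.sum_eq_zero fun m _ => ?_
  simp only [mul_assoc, ← Finset.mul_sum, sum_spinTwoVec_mul_mpsMat, mul_zero]

section GroundState

variable {N : ℕ} [NeZero N]

/-- `Q` is the product of the matrices of the other N - 2 sites, which the state of the pair does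
not affect. -/
theorem exists_mpsAmp_pairUpdate (hN : 2 ≤ N) (j : ZMod N) (s : ZMod N → Fin 3) :
    ∃ Q : Matrix (Fin 2) (Fin 2) ℝ, ∀ q, mpsAmp (pairUpdate j s q) =
      ∑ a, ∑ b, (mpsMat q.1 * mpsMat q.2) a b * Q b a := by
  refine ⟨seqProd (fun k => mpsMat (s (j + ((2 + k : ℕ) : ZMod N)))) (N - 2), fun q => ?_⟩
  rw [mpsAmp_eq_trace _ j]
  have h2 : seqProd (fun k => mpsMat (pairUpdate j s q (j + (k : ZMod N)))) N =
      seqProd (fun k => mpsMat (pairUpdate j s q (j + (k : ZMod N)))) (2 + (N - 2)) := by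
    rw [Nat.add_sub_cancel' hN]
  have hoff : seqProd (fun k => mpsMat (pairUpdate j s q (j + ((2 + k : ℕ) : ZMod N)))) (N - 2) =
      seqProd (fun k => mpsMat (s (j + ((2 + k : ℕ) : ZMod N)))) (N - 2) := by
    refine seqProd_congr fun k hk => ?_
    rw [pairUpdate_of_ne]
    · intro h
      have := zmod_add_natCast_inj (j := j) (a := 2 + k) (b := 0) (by omega) (by omega)
        (by simpa using h)
      omega
    · intro h
      have := zmod_add_natCast_inj (j := j) (a := 2 + k) (b := 1) (by omega) (by omega)
        (by simpa using h)
      omega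
  rw [h2, seqProd_add, hoff]
  simp only [seqProd, Nat.cast_zero, add_zero, Nat.cast_one, one_mul,
    pairUpdate_left s q (self_ne_add_one hN j), pairUpdate_right]
  simp only [Matrix.trace, Matrix.diag_apply]
  rfl

theorem localAction_spinTwoProj_akltState (hN : 2 ≤ N) (j : ZMod N) :
    localAction j (spinTwoProj.map (Int.cast : ℤ → ℂ)) (akltState N) = 0 := by
  funext s
  obtain ⟨Q, hQ⟩ := exists_mpsAmp_pairUpdate hN j s
  have h : ∑ q, (spinTwoProj (s j, s (j + 1)) q : ℝ) * mpsAmp (pairUpdate j s q) = 0 := by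
    simp only [hQ, Finset.mul_sum, ← mul_assoc]
    rw [Finset.sum_comm]
    refine Finset.sum_eq_zero fun a _ => ?_
    rw [Finset.sum_comm]
    refine Finset.sum_eq_zero fun b _ => ?_
    rw [← Finset.sum_mul, sum_spinTwoProj_mul_mpsMat, zero_mul]
  have h' : localAction j (spinTwoProj.map (Int.cast : ℤ → ℂ)) (akltState N) s =
      (((√(mpsNormSq N))⁻¹ * ∑ q, (spinTwoProj (s j, s (j + 1)) q : ℝ) *
        mpsAmp (pairUpdate j s q) : ℝ) : ℂ) := by
    simp only [localAction, akltState_apply, Matrix.map_apply]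
    push_cast
    rw [Finset.mul_sum]
    exact Finset.sum_congr rfl fun q _ => by ring
  rw [h', h, mul_zero]
  rfl

theorem spinDot_mulVec (hN : 2 ≤ N) (j : ZMod N) (φ : (ZMod N → Fin 3) → ℂ) :
    (spinDot j).mulVec φ = localAction j (coupling.map (Int.cast : ℤ → ℂ)) φ := by
  rw [spinDot, Matrix.sum_mulVec]
  simp only [siteOp_eq_siteHom, siteHom_mul_siteHom_mulVec (self_ne_add_one hN j)]
  rw [← coupling_eq]
  funext s
  simp only [Finset.sum_apply, localAction, Matrix.of_apply, Finset.sum_mul]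
  exact Finset.sum_comm

/-- This is `coupling_quadratic` divided by three: a bond term is twice the spin-two projection
minus 2/3. -/
theorem bond_mulVec (hN : 2 ≤ N) (j : ZMod N) (φ : (ZMod N → Fin 3) → ℂ) :
    (spinDot j + (1 / 3 : ℂ) • (spinDot j * spinDot j)).mulVec φ =
      (1 / 3 : ℂ) • localAction j (spinTwoProj.map (Int.cast : ℤ → ℂ)) φ - (2 / 3 : ℂ) • φ := by
  have hj := self_ne_add_one hN j
  have hq : coupling.map (Int.cast : ℤ → ℂ) +
      (1 / 3 : ℂ) • (coupling.map (Int.cast : ℤ → ℂ) * coupling.map (Int.cast : ℤ → ℂ)) =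
      (1 / 3 : ℂ) • spinTwoProj.map (Int.cast : ℤ → ℂ) + (-2 / 3 : ℂ) • 1 := by
    have := congrArg (Int.castRingHom ℂ).mapMatrix coupling_quadratic
    simp only [map_add, map_mul, map_sub, map_ofNat] at this
    change coupling.map (Int.cast : ℤ → ℂ) * coupling.map (Int.cast : ℤ → ℂ) +
      3 * coupling.map (Int.cast : ℤ → ℂ) = spinTwoProj.map (Int.cast : ℤ → ℂ) - 2 at this
    rw [eq_sub_of_add_eq this]
    have h3 : (3 : Matrix (Fin 3 × Fin 3) (Fin 3 × Fin 3) ℂ) = (3 : ℂ) • 1 := by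
      rw [Matrix.smul_one_eq_diagonal]; rfl
    have h2 : (2 : Matrix (Fin 3 × Fin 3) (Fin 3 × Fin 3) ℂ) = (2 : ℂ) • 1 := by
      rw [Matrix.smul_one_eq_diagonal]; rfl
    rw [h3, h2, smul_one_mul]
    module
  rw [Matrix.add_mulVec, Matrix.smul_mulVec, ← Matrix.mulVec_mulVec, spinDot_mulVec hN,
    spinDot_mulVec hN, localAction_mul hj, ← localAction_smul, ← localAction_add, hq,
    localAction_add, localAction_smul, localAction_smul, localAction_one]
  module

theorem re_star_dotProduct_self_nonneg {κ : Type*} [Fintype κ] (v : κ → ℂ) :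
    0 ≤ (star v ⬝ᵥ v).re :=
  (Complex.le_def.mp (dotProduct_star_self_nonneg v)).1

/-- For K six times the projection, K² = 6K gives ⟨K⟩ = ‖Kφ‖²/6; with the factor 1/3 of the bond
term this is the 1/18. In this form every bond visibly has energy at least -2/3. -/
theorem energy_akltHamiltonian (hN : 2 ≤ N) {φ : EuclideanSpace ℂ (ZMod N → Fin 3)}
    (hφ : ‖φ‖ = 1) :
    energy (akltHamiltonian N) φ = ∑ j : ZMod N,
      (1 / 18 * (star (localAction j (spinTwoProj.map (Int.cast : ℤ → ℂ)) φ) ⬝ᵥ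
        localAction j (spinTwoProj.map (Int.cast : ℤ → ℂ)) φ).re - 2 / 3) := by
  have hnorm : star (φ : (ZMod N → Fin 3) → ℂ) ⬝ᵥ φ = 1 := by
    have := EuclideanSpace.inner_eq_star_dotProduct φ φ
    rw [inner_self_eq_norm_sq_to_K, hφ] at this
    rw [dotProduct_comm, ← this]
    simp
  rw [energy, akltHamiltonian, Matrix.sum_mulVec, dotProduct_sum, Complex.re_sum]
  refine Finset.sum_congr rfl fun j _ => ?_
  have hsq : spinTwoProj.map (Int.cast : ℤ → ℂ) * spinTwoProj.map (Int.cast : ℤ → ℂ) =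
      (6 : ℂ) • spinTwoProj.map (Int.cast : ℤ → ℂ) := by
    have := congrArg (Int.castRingHom ℂ).mapMatrix spinTwoProj_mul_self
    simp only [map_mul, map_ofNat] at this
    have h6 : (6 : Matrix (Fin 3 × Fin 3) (Fin 3 × Fin 3) ℂ) = (6 : ℂ) • 1 := by
      rw [Matrix.smul_one_eq_diagonal]; rfl
    rw [h6, smul_one_mul] at this
    exact this
  have hherm : (spinTwoProj.map (Int.cast : ℤ → ℂ)).conjTranspose =
      spinTwoProj.map (Int.cast : ℤ → ℂ) := by
    conv_rhs => rw [← spinTwoProj_transpose]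
    ext p q
    simp
  have h6 : star (φ : (ZMod N → Fin 3) → ℂ) ⬝ᵥ
      localAction j (spinTwoProj.map (Int.cast : ℤ → ℂ)) φ =
      (1 / 6 : ℂ) * (star (localAction j (spinTwoProj.map (Int.cast : ℤ → ℂ)) φ) ⬝ᵥ
        localAction j (spinTwoProj.map (Int.cast : ℤ → ℂ)) φ) := by
    conv_rhs => rw [← hherm]
    rw [← dotProduct_localAction (self_ne_add_one hN j), hherm,
      localAction_mul (self_ne_add_one hN j), hsq, localAction_smul, dotProduct_smul, smul_eq_mul]
    ring
  rw [bond_mulVec hN, dotProduct_sub, dotProduct_smul, dotProduct_smul, hnorm, h6, smul_eq_mul,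
    smul_eq_mul, ← mul_assoc]
  rw [show (1 / 3 * (1 / 6) : ℂ) = ((1 / 18 : ℝ) : ℂ) by push_cast; norm_num,
    show (2 / 3 * 1 : ℂ) = ((2 / 3 : ℝ) : ℂ) by push_cast; norm_num, Complex.sub_re,
    Complex.re_ofReal_mul, Complex.ofReal_re]

theorem isGroundState_akltState (hN : 2 ≤ N) :
    IsGroundState (akltHamiltonian N) (akltState N) := by
  refine ⟨norm_akltState hN, fun φ hφ => ?_⟩
  rw [energy_akltHamiltonian hN (norm_akltState hN), energy_akltHamiltonian hN hφ]
  refine Finset.sum_le_sum fun j _ => ?_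
  rw [localAction_spinTwoProj_akltState hN]
  have := re_star_dotProduct_self_nonneg
    (localAction j (spinTwoProj.map (Int.cast : ℤ → ℂ)) φ)
  simp only [dotProduct_zero, Complex.zero_re]
  linarith

end GroundState

/-! ### The branches in which the pair is cut out -/

/-- Each of the three matrices has at most one non-zero entry per row and per column, so its product
with a matrix unit is again a multiple of one. The table gives the column of that entry for each
outcome and row, with an arbitrary value where the row vanishes. -/
theorem mpsMat_row (o : Fin 3) (b : Fin 2) :
    ∃ (g : Fin 2) (x : ℝ), ∀ t, mpsMat o b t = if g = t then x else 0 := by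
  refine ⟨(![![1, 0], ![0, 0], ![0, 1]] : Fin 3 → Fin 2 → Fin 2) o b,
    mpsMat o b ((![![1, 0], ![0, 0], ![0, 1]] : Fin 3 → Fin 2 → Fin 2) o b), fun t => ?_⟩
  fin_cases o <;> fin_cases b <;> fin_cases t <;> simp [mpsMat]

theorem mpsMat_col (o : Fin 3) (b : Fin 2) :
    ∃ (g : Fin 2) (x : ℝ), ∀ t, mpsMat o t b = if g = t then x else 0 := by
  refine ⟨(![![0, 0], ![1, 0], ![0, 1]] : Fin 3 → Fin 2 → Fin 2) o b,
    mpsMat o ((![![0, 0], ![1, 0], ![0, 1]] : Fin 3 → Fin 2 → Fin 2) o b) b, fun t => ?_⟩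
  fin_cases o <;> fin_cases b <;> fin_cases t <;> simp [mpsMat]

theorem single_mul_mpsMat (a b : Fin 2) (c : ℝ) (o : Fin 3) :
    ∃ b' c', Matrix.single a b c * mpsMat o = Matrix.single a b' c' := by
  obtain ⟨g, x, h⟩ := mpsMat_row o b
  refine ⟨g, c * x, ?_⟩
  ext i t
  by_cases hi : a = i
  · subst hi
    rw [Matrix.single_mul_apply_same, h, Matrix.single_apply]
    simp
  · rw [Matrix.single_mul_apply_of_ne _ _ _ _ _ (Ne.symm hi), Matrix.single_apply]
    simp [hi]

theorem mpsMat_mul_single (a b : Fin 2) (c : ℝ) (o : Fin 3) :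
    ∃ a' c', mpsMat o * Matrix.single a b c = Matrix.single a' b c' := by
  obtain ⟨g, x, h⟩ := mpsMat_col o a
  refine ⟨g, x * c, ?_⟩
  ext i t
  by_cases ht : b = t
  · subst ht
    rw [Matrix.mul_single_apply_same, h, Matrix.single_apply]
    simp
  · rw [Matrix.mul_single_apply_of_ne _ _ _ _ _ (Ne.symm ht), Matrix.single_apply]
    simp [ht]

theorem seqProd_mul_single (t : ℕ → Fin 3) (n : ℕ) (a b : Fin 2) (c : ℝ) :
    ∃ a' c', seqProd (fun k => mpsMat (t k)) n * Matrix.single a b c = Matrix.single a' b c' := by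
  induction n generalizing a c with
  | zero => exact ⟨a, c, by rw [seqProd, one_mul]⟩
  | succ n ih =>
    obtain ⟨a', c', h⟩ := mpsMat_mul_single a b c (t n)
    obtain ⟨a'', c'', h'⟩ := ih a' c'
    exact ⟨a'', c'', by rw [seqProd, mul_assoc, h, h']⟩

/-- An ordered product that contains an outcome other than `2̃` is a multiple of a matrix unit. -/
theorem exists_seqProd_eq_single {t : ℕ → Fin 3} {n k : ℕ} (hk : k < n) (ht : t k ≠ 2) :
    ∃ a b c, seqProd (fun k => mpsMat (t k)) n = Matrix.single a b c := by
  induction n with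
  | zero => omega
  | succ n ih =>
    rcases Nat.lt_succ_iff_lt_or_eq.mp hk with h | rfl
    · obtain ⟨a, b, c, h⟩ := ih h
      obtain ⟨b', c', h'⟩ := single_mul_mpsMat a b c (t n)
      exact ⟨a, b', c', by rw [seqProd, h, h']⟩
    -- The given outcome is the last factor: its matrix is a multiple of a matrix unit, and the
    -- factors before it preserve this form.
    · have : ∃ a b c, mpsMat (t k) = Matrix.single a b c := by
        generalize t k = o at ht
        fin_cases o
        · exact ⟨0, 1, (√2)⁻¹, by ext i l; fin_cases i <;> fin_cases l <;> simp [mpsMat]⟩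
        · exact ⟨1, 0, -(√2)⁻¹, by ext i l; fin_cases i <;> fin_cases l <;> simp [mpsMat]⟩
        · exact absurd rfl ht
      obtain ⟨a, b, c, h⟩ := this
      obtain ⟨a', c', h'⟩ := seqProd_mul_single t k a b c
      exact ⟨a', b, c', by rw [seqProd, h, h']⟩

/-- Two matrix units cut the ring open: the pair, in `P`, and the rest, in `Q`, contribute separate
scalar factors. -/
theorem trace_single_mul_mul_single_mul (a i k b : Fin 2) (c c' : ℝ)
    (P Q : Matrix (Fin 2) (Fin 2) ℝ) :
    (Matrix.single a i c * (P * (Matrix.single k b c' * Q))).trace = c * c' * Q b a * P i k := by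
  rw [Matrix.trace_single_mul]
  simp only [Matrix.mul_apply, Matrix.single_apply, ite_mul, zero_mul, ite_and]
  simp
  ring

/-- The unnormalized amplitudes `P_A P_B |i⟩ |ψ⁻⟩ |k⟩` of a pair that is cut out, up to a sign. -/
noncomputable def pairAmp (i k : Fin 2) (p : Fin 3 × Fin 3) : ℝ :=
  (mpsMat p.1 * mpsMat p.2) i (k + 1)

section Branches

variable {N n : ℕ}

/-- The configuration `s` is compatible with the outcomes `μ`. -/
def Matches {j : ZMod N} (μ : Branch j n) (s : ZMod N → Fin 3) : Prop := ∀ i, s i.1 = μ i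

theorem matches_pairUpdate (hN : 2 * n + 2 ≤ N) {j : ZMod N} (μ : Branch j n)
    (s : ZMod N → Fin 3) (q : Fin 3 × Fin 3) :
    Matches μ (pairUpdate j s q) ↔ Matches μ s := by
  refine forall_congr' fun i => ?_
  rw [pairUpdate_of_ne]
  · exact fun h => self_notMem_blocks hN j
      (Set.mem_of_eq_of_mem (s := (leftBlock j n ∪ rightBlock j n : Finset (ZMod N))) h.symm i.2)
  · exact fun h => add_one_notMem_blocks hN j (h ▸ i.2 : j + 1 ∈ leftBlock j n ∪ rightBlock j n)

variable [NeZero N]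

/-- In a branch in which the pair is cut out, the state of the pair factorizes. -/
theorem IsCut.exists_factorization (hN : 2 * n + 2 ≤ N) {j : ZMod N} {μ : Branch j n}
    (hμ : IsCut μ) : ∃ (i k : Fin 2) (f : (ZMod N → Fin 3) → ℝ),
      (∀ s q, f (pairUpdate j s q) = f s) ∧
      ∀ s, Matches μ s → mpsAmp s = f s * pairAmp i k (s j, s (j + 1)) := by
  -- The outcomes, listed by offset from the leftmost measured site. The default 0 at offsets
  -- outside the blocks plays no role.
  let t : ℕ → Fin 3 := fun k => if h : j - n + (k : ZMod N) ∈ leftBlock j n ∪ rightBlock j n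
    then μ ⟨_, h⟩ else 0
  have htl : ∃ k < n, t k ≠ 2 := by
    obtain ⟨⟨i, hi'⟩, hi, h⟩ := hμ.1
    obtain ⟨k, hk, rfl⟩ := mem_leftBlock.mp hi
    exact ⟨k, hk, by simpa only [t, dif_pos hi'] using h⟩
  have htr : ∃ k < n, t (n + (2 + k)) ≠ 2 := by
    obtain ⟨⟨i, hi'⟩, hi, h⟩ := hμ.2
    obtain ⟨k, hk, rfl⟩ := mem_rightBlock.mp hi
    refine ⟨k, hk, ?_⟩
    rw [← add_assoc]
    simpa only [t, dif_pos hi'] using h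
  obtain ⟨kl, hkl, hl⟩ := htl
  obtain ⟨kr, hkr, hr⟩ := htr
  obtain ⟨a, i, c, hL⟩ := exists_seqProd_eq_single hkl hl
  obtain ⟨k, b, c', hR⟩ := exists_seqProd_eq_single (t := fun k => t (n + (2 + k))) hkr hr
  -- The N - 2n - 2 sites that are neither measured nor in the pair.
  let Q : (ZMod N → Fin 3) → Matrix (Fin 2) (Fin 2) ℝ := fun s =>
    seqProd (fun k => mpsMat (s (j - n + ((n + (2 + (n + k)) : ℕ) : ZMod N)))) (N - (2 * n + 2))
  -- `pairAmp` shifts its second index by one, since a singlet joins opposite basis states; the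
  -- extra shift here undoes this modulo 2.
  refine ⟨i, k + 1, fun s => c * c' * Q s b a, fun s q => ?_, fun s hs => ?_⟩
  · have : Q (pairUpdate j s q) = Q s := by
      refine seqProd_congr fun l hl => ?_
      rw [pairUpdate_of_ne]
      · intro h
        have := zmod_add_natCast_inj (by omega) (by omega) (h.trans (self_eq_sub_add j n))
        omega
      · intro h
        have := zmod_add_natCast_inj (by omega) (by omega) (h.trans (add_one_eq_sub_add j n))
        omega
    simp only [this]
  · have hst : ∀ l : ℕ, j - n + (l : ZMod N) ∈ leftBlock j n ∪ rightBlock j n →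
        s (j - n + (l : ZMod N)) = t l := fun l h => by
      simp only [t, dif_pos h]
      exact hs ⟨_, h⟩
    have hN' : N = n + (2 + (n + (N - (2 * n + 2)))) := by omega
    have hk : k + 1 + 1 = k := by fin_cases k <;> rfl
    have hsplit : seqProd (fun k => mpsMat (s (j - n + (k : ZMod N)))) N =
        seqProd (fun k => mpsMat (s (j - n + (k : ZMod N))))
          (n + (2 + (n + (N - (2 * n + 2))))) := by rw [← hN']
    rw [mpsAmp_eq_trace s (j - n), hsplit, seqProd_add, seqProd_add, seqProd_add]
    have h1 : seqProd (fun k => mpsMat (s (j - n + (k : ZMod N)))) n = Matrix.single a i c := by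
      rw [← hL]
      exact seqProd_congr fun l hl => by
        rw [hst l (Finset.mem_union_left _ (mem_leftBlock.mpr ⟨l, hl, rfl⟩))]
    have h2 : seqProd (fun k => mpsMat (s (j - n + ((n + (2 + k) : ℕ) : ZMod N)))) n =
        Matrix.single k b c' := by
      rw [← hR]
      refine seqProd_congr fun l hl => ?_
      rw [hst _ (Finset.mem_union_right _ (mem_rightBlock.mpr ⟨l, hl, by rw [add_assoc]⟩))]
    have h3 : seqProd (fun k => mpsMat (s (j - n + ((n + k : ℕ) : ZMod N)))) 2 =
        mpsMat (s j) * mpsMat (s (j + 1)) := by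
      simp only [seqProd, one_mul, add_zero]
      rw [← self_eq_sub_add, ← add_one_eq_sub_add]
    rw [h1, h2, h3, trace_single_mul_mul_single_mul, pairAmp, hk]

/-- Summing out the two spins of the pair. -/
theorem sum_mul_pair (hN : 2 ≤ N) {R : Type*} [CommSemiring R] (j : ZMod N)
    {h : (ZMod N → Fin 3) → R} (hh : ∀ s q, h (pairUpdate j s q) = h s)
    (w : Fin 3 × Fin 3 → R) (p : Fin 3 × Fin 3) :
    ∑ s, h s * w (s j, s (j + 1)) =
      (∑ s, if s j = p.1 ∧ s (j + 1) = p.2 then h s else 0) * ∑ q, w q := by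
  have hj := self_ne_add_one hN j
  -- Resetting the pair to another state is a bijection that `h` does not see, so the partial sum is
  -- the same for every state of the pair.
  have hind : ∀ q : Fin 3 × Fin 3, (∑ s, if s j = q.1 ∧ s (j + 1) = q.2 then h s else 0) =
      ∑ s, if s j = p.1 ∧ s (j + 1) = p.2 then h s else 0 := by
    intro q
    rw [← Finset.sum_filter, ← Finset.sum_filter]
    refine Finset.sum_nbij' (fun s => pairUpdate j s p) (fun s => pairUpdate j s q) ?_ ?_ ?_ ?_ ?_
    · intro s _
      simp [pairUpdate_left s p hj, pairUpdate_right]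
    · intro s _
      simp [pairUpdate_left s q hj, pairUpdate_right]
    · intro s hs
      obtain ⟨h1, h2⟩ := (Finset.mem_filter.mp hs).2
      have : q = (s j, s (j + 1)) := by rw [h1, h2]
      rw [pairUpdate_pairUpdate, this, pairUpdate_self]
    · intro s hs
      obtain ⟨h1, h2⟩ := (Finset.mem_filter.mp hs).2
      have : p = (s j, s (j + 1)) := by rw [h1, h2]
      rw [pairUpdate_pairUpdate, this, pairUpdate_self]
    · intro s _
      exact (hh s p).symm
  have hsplit : ∀ s, h s * w (s j, s (j + 1)) =
      ∑ q, (if s j = q.1 ∧ s (j + 1) = q.2 then h s else 0) * w q := by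
    intro s
    rw [Finset.sum_eq_single (s j, s (j + 1))]
    · simp
    · intro q _ hq
      rw [if_neg, zero_mul]
      rintro ⟨h1, h2⟩
      exact hq (by rw [h1, h2])
    · simp
  rw [Finset.sum_congr rfl fun s _ => hsplit s, Finset.sum_comm, Finset.mul_sum]
  exact Finset.sum_congr rfl fun q _ => by rw [← Finset.sum_mul, hind]

end Branches

/-! ### The state of a pair that is cut out -/

section PairState

/-- A singlet joins opposite basis states, so contracting it onto the right qubit of the second site
only shifts the index `k` by one and multiplies by ±1/√2. The constant undoes that factor. -/
theorem pairVec_sum_eq (i k : Fin 2) : ∃ c : ℝ, c ≠ 0 ∧ ∀ p : Fin 3 × Fin 3,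
    ∑ x, ∑ y, star (tripletBasis p.1 i x) * singlet x y * star (tripletBasis p.2 y k) =
      ((c * pairAmp i k p : ℝ) : ℂ) := by
  let e : ℝ := if k = 0 then √2 else -√2
  have he : ∀ y : Fin 2, ∀ o : Fin 3,
      star (tripletBasis o y k) = ((e * mpsMat o y (k + 1) : ℝ) : ℂ) := by
    intro y o
    have hinv : ((√2 : ℝ) : ℂ)⁻¹ = (√2 : ℝ) * (1 / 2) := by
      rw [inv_eq_iff_eq_inv, mul_inv, eq_comm]
      field_simp
      have h4 : ((√2 : ℝ) : ℂ) ^ 2 = 2 := by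
        rw [← Complex.ofReal_pow, Real.sq_sqrt (by norm_num)]; norm_num
      rw [h4]
    fin_cases k <;> fin_cases y <;> fin_cases o <;>
      simp [tripletBasis, mpsMat, e, Complex.conj_ofReal] <;> rw [hinv] <;> ring
  refine ⟨e, by simp only [e]; split_ifs <;> simp, fun p => ?_⟩
  rw [Finset.sum_comm]
  simp only [← Finset.sum_mul, sum_tripletBasis_mul_singlet, he, pairAmp, Matrix.mul_apply,
    Finset.mul_sum]
  push_cast
  exact Finset.sum_congr rfl fun y _ => by ring

theorem sum_pairAmp_sq_pos (i k : Fin 2) : 0 < ∑ p, pairAmp i k p ^ 2 := by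
  have h : ∃ p, pairAmp i k p ≠ 0 := by
    fin_cases i <;> fin_cases k
    · exact ⟨(0, 2), by simp [pairAmp, mpsMat, Matrix.mul_apply]⟩
    · exact ⟨(2, 2), by simp [pairAmp, mpsMat, Matrix.mul_apply]⟩
    · exact ⟨(2, 2), by simp [pairAmp, mpsMat, Matrix.mul_apply]⟩
    · exact ⟨(1, 2), by simp [pairAmp, mpsMat, Matrix.mul_apply]⟩
  obtain ⟨p, hp⟩ := h
  exact Finset.sum_pos' (fun _ _ => sq_nonneg _) ⟨p, Finset.mem_univ _, by positivity⟩

/-- The sign of the constant may stay open, because only its square enters the projection onto the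
vector. -/
theorem pairVec_apply (i k : Fin 2) : ∃ c : ℝ, c ^ 2 = (∑ p, pairAmp i k p ^ 2)⁻¹ ∧
    ∀ p, pairVec i k p = ((c * pairAmp i k p : ℝ) : ℂ) := by
  obtain ⟨c, hc, h⟩ := pairVec_sum_eq i k
  have hpos := sum_pairAmp_sq_pos i k
  have h' : pairVec i k = unitVec (WithLp.toLp 2 fun p => ((c * pairAmp i k p : ℝ) : ℂ)) := by
    rw [pairVec]
    congr 2
    funext p
    exact h p
  refine ⟨(√(∑ p, (c * pairAmp i k p) ^ 2))⁻¹ * c, ?_, fun p => ?_⟩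
  · rw [mul_pow, inv_pow, Real.sq_sqrt (Finset.sum_nonneg fun _ _ => sq_nonneg _)]
    simp only [mul_pow, ← Finset.mul_sum]
    field_simp
  · rw [h', unitVec, EuclideanSpace.norm_eq]
    simp [mul_assoc, mul_pow]

/-- All 2 × 2 minors of a product vector vanish. Each of the four vectors has exactly two non-zero
amplitudes, in different rows and columns, and hence a non-zero minor. -/
theorem isEntangled_pairVec (i k : Fin 2) : IsEntangled (pairVec i k) := by
  rintro ⟨u, v, h⟩
  obtain ⟨c, hc, hv⟩ := pairVec_apply i k
  have hc0 : c ≠ 0 := by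
    rintro rfl
    have := inv_pos.mpr (sum_pairAmp_sq_pos i k)
    rw [← hc] at this
    simp at this
  have hminor : ∀ a a' b b', pairAmp i k (a, b) * pairAmp i k (a', b') =
      pairAmp i k (a, b') * pairAmp i k (a', b) := by
    intro a a' b b'
    have : pairVec i k (a, b) * pairVec i k (a', b') =
        pairVec i k (a, b') * pairVec i k (a', b) := by
      rw [h, h, h, h]; ring
    simp only [hv] at this
    have h2 : c * pairAmp i k (a, b) * (c * pairAmp i k (a', b')) =
        c * pairAmp i k (a, b') * (c * pairAmp i k (a', b)) := by exact_mod_cast this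
    have h3 : c ^ 2 * (pairAmp i k (a, b) * pairAmp i k (a', b')) =
        c ^ 2 * (pairAmp i k (a, b') * pairAmp i k (a', b)) := by linarith
    exact mul_left_cancel₀ (pow_ne_zero 2 hc0) h3
  fin_cases i <;> fin_cases k
  · have := hminor 0 2 2 0
    simp [pairAmp, mpsMat, Matrix.mul_apply] at this
  · have := hminor 0 2 1 2
    simp [pairAmp, mpsMat, Matrix.mul_apply] at this
  · have := hminor 1 2 0 2
    simp [pairAmp, mpsMat, Matrix.mul_apply] at this
  · have := hminor 1 2 2 1
    simp [pairAmp, mpsMat, Matrix.mul_apply] at this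

variable {N n : ℕ} [NeZero N]

/-- The factorization of the AKLT state in a branch, with state `(i, k)` of the pair. -/
def Factorizes {j : ZMod N} (μ : Branch j n) (i k : Fin 2) : Prop :=
  ∃ f : (ZMod N → Fin 3) → ℝ, (∀ s q, f (pairUpdate j s q) = f s) ∧
    ∀ s, Matches μ s → akltState N s = ((f s * pairAmp i k (s j, s (j + 1)) : ℝ) : ℂ)

theorem IsCut.factorizes (hN : 2 * n + 2 ≤ N) {j : ZMod N} {μ : Branch j n} (hμ : IsCut μ) :
    ∃ i k, Factorizes μ i k := by
  obtain ⟨i, k, f, hf, h⟩ := hμ.exists_factorization hN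
  refine ⟨i, k, fun s => (√(mpsNormSq N))⁻¹ * f s, fun s q => by simp only [hf], fun s hs => ?_⟩
  rw [akltState_apply, h s hs, mul_assoc]

open Classical in
theorem branchProb_eq (ψ : EuclideanSpace ℂ (ZMod N → Fin 3)) {j : ZMod N} (μ : Branch j n) :
    branchProb ψ μ = ∑ s : ZMod N → Fin 3, if Matches μ s then ‖ψ s‖ ^ 2 else 0 :=
  Finset.sum_congr rfl fun _ _ => if_congr Iff.rfl rfl rfl

open Classical in
-- Neither `f` nor compatibility with `μ` sees the pair, so the sum over its states splits off. The
-- other factor refers to a fixed state `p` because it occurs in this form in the entries of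
-- `pairState`.
theorem Factorizes.branchProb_eq (hN : 2 * n + 2 ≤ N) {j : ZMod N} {μ : Branch j n} {i k : Fin 2}
    {f : (ZMod N → Fin 3) → ℝ} (hf : ∀ s q, f (pairUpdate j s q) = f s)
    (h : ∀ s, Matches μ s → akltState N s = ((f s * pairAmp i k (s j, s (j + 1)) : ℝ) : ℂ))
    (p : Fin 3 × Fin 3) :
    branchProb (akltState N) μ =
      (∑ s, if s j = p.1 ∧ s (j + 1) = p.2 then (if Matches μ s then f s ^ 2 else 0) else 0) *
        ∑ q, pairAmp i k q ^ 2 := by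
  rw [← sum_mul_pair (by omega) j (fun s q => by simp only [hf, matches_pairUpdate hN])
    (fun q => pairAmp i k q ^ 2) p, _root_.branchProb_eq]
  refine Finset.sum_congr rfl fun s _ => ?_
  split_ifs with hs
  · rw [h s hs, Complex.norm_real, Real.norm_eq_abs, sq_abs, mul_pow]
  · rw [zero_mul]

/-- The state of a pair that is cut out. -/
theorem Factorizes.pairState_eq (hN : 2 * n + 2 ≤ N) {j : ZMod N} {μ : Branch j n} {i k : Fin 2}
    (hμ : Factorizes μ i k) (h0 : branchProb (akltState N) μ ≠ 0) :
    pairState (akltState N) μ =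
      Matrix.vecMulVec (pairVec i k) (star (pairVec i k : Fin 3 × Fin 3 → ℂ)) := by
  classical
  obtain ⟨f, hf, h⟩ := hμ
  obtain ⟨c, hc, hv⟩ := pairVec_apply i k
  ext p q
  have hb := Factorizes.branchProb_eq hN hf h p
  set G := ∑ s, if s j = p.1 ∧ s (j + 1) = p.2 then
    (if Matches μ s then f s ^ 2 else 0) else 0 with hG
  have hsum : (∑ s : ZMod N → Fin 3, if (∀ i, s i.1 = μ i) ∧ s j = p.1 ∧ s (j + 1) = p.2 then
      akltState N s * star (akltState N (Function.update (Function.update s j q.1) (j + 1) q.2))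
      else 0) = ((G * (pairAmp i k p * pairAmp i k q) : ℝ) : ℂ) := by
    rw [hG, Finset.sum_mul, Complex.ofReal_sum]
    refine Finset.sum_congr rfl fun s _ => ?_
    by_cases hs : Matches μ s
    · by_cases hp : s j = p.1 ∧ s (j + 1) = p.2
      · rw [if_pos ⟨hs, hp⟩, if_pos hp, if_pos hs, h s hs]
        have hs' := (matches_pairUpdate hN μ s q).mpr hs
        change _ * star (akltState N (pairUpdate j s q)) = _
        rw [h _ hs', hf, pairUpdate_left _ _ (self_ne_add_one (by omega) j), pairUpdate_right,
          hp.1, hp.2, Complex.star_def, Complex.conj_ofReal, ← Complex.ofReal_mul]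
        congr 1
        ring
      · rw [if_neg fun h => hp h.2, if_neg hp, zero_mul, Complex.ofReal_zero]
    · rw [if_neg fun h => hs h.1, if_neg hs, ite_self, zero_mul, Complex.ofReal_zero]
  simp only [pairState, Matrix.of_apply, Matrix.vecMulVec_apply, Pi.star_apply]
  rw [hsum, hv, hv, Complex.star_def, Complex.conj_ofReal, ← Complex.ofReal_mul,
    ← Complex.ofReal_mul]
  congr 1
  have hG0 : G ≠ 0 := fun h => h0 (by rw [hb, h, zero_mul])
  have hS := (sum_pairAmp_sq_pos i k).ne'
  rw [hb]
  calc _ = (∑ q, pairAmp i k q ^ 2)⁻¹ * (pairAmp i k p * pairAmp i k q) := by field_simp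
    _ = _ := by rw [← hc]; ring

end PairState

/-! ### Optimal measurements for the states of the pair -/

section Observables

/-- The qubit observable `z Z + x X` on the levels `u, v` of a spin one; the third level has the
outcome `+1`. -/
def levelObs (u v : Fin 3) (z x : ℝ) : Matrix (Fin 3) (Fin 3) ℝ :=
  Matrix.of fun a b => if a = u ∧ b = u then z else if a = v ∧ b = v then -z
    else if a = u ∧ b = v ∨ a = v ∧ b = u then x else if a = b then 1 else 0

theorem levelObs_transpose (u v : Fin 3) (z x : ℝ) :
    (levelObs u v z x).transpose = levelObs u v z x := by
  ext a b
  simp only [levelObs, Matrix.transpose_apply, Matrix.of_apply, and_comm, or_comm, eq_comm]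

theorem levelObs_mul_self {u v : Fin 3} (huv : u ≠ v) {z x : ℝ} (h : z ^ 2 + x ^ 2 = 1) :
    levelObs u v z x * levelObs u v z x = 1 := by
  ext a b
  rw [Matrix.mul_apply]
  fin_cases u <;> fin_cases v <;> first | exact absurd rfl huv | skip
  all_goals
    fin_cases a <;> fin_cases b <;>
      simp [levelObs, Fin.sum_univ_three] <;> linarith

/-- The effects of the measurement of an involution. -/
noncomputable def obsEffect (A : Matrix (Fin 3) (Fin 3) ℝ) (a : Fin 2) : Matrix (Fin 3) (Fin 3) ℝ :=
  (1 / 2 : ℝ) • (1 + outcomeSign a • A)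

/-- The effects of an involution are its spectral projections, hence of the form E†E. -/
theorem isPOVM_obsEffect {A : Matrix (Fin 3) (Fin 3) ℝ} (hA : A.transpose = A)
    (hA' : A * A = 1) : IsPOVM fun a => (obsEffect A a).map (Complex.ofReal : ℝ → ℂ) := by
  constructor
  · intro a
    have h1 : obsEffect A a * obsEffect A a = obsEffect A a := by
      have hs : outcomeSign a * outcomeSign a = 1 := by
        fin_cases a <;> simp [outcomeSign]
      have : (outcomeSign a • A) * (outcomeSign a • A) = 1 := by
        rw [smul_mul_smul_comm, hs, hA', one_smul]
      simp only [obsEffect, smul_mul_smul_comm, add_mul, mul_add, this, one_mul, mul_one]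
      module
    have h2 : (obsEffect A a).map (Complex.ofReal : ℝ → ℂ) =
        ((obsEffect A a).map (Complex.ofReal : ℝ → ℂ)).conjTranspose *
          (obsEffect A a).map (Complex.ofReal : ℝ → ℂ) := by
      have h3 : ((obsEffect A a).map (Complex.ofReal : ℝ → ℂ)).conjTranspose =
          (obsEffect A a).map (Complex.ofReal : ℝ → ℂ) := by
        have h4 : (obsEffect A a).transpose = obsEffect A a := by
          simp [obsEffect, hA]
        conv_rhs => rw [← h4]
        ext i j
        simp [Complex.conj_ofReal]
      rw [h3]
      conv_lhs => rw [← h1]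
      exact map_mul Complex.ofRealHom.mapMatrix _ _
    change ((obsEffect A a).map (Complex.ofReal : ℝ → ℂ)).PosSemidef
    rw [h2]
    exact Matrix.posSemidef_conjTranspose_mul_self _
  · have h : ∑ a, obsEffect A a = 1 := by
      simp only [Fin.sum_univ_two, obsEffect, outcomeSign, Matrix.cons_val_zero,
        Matrix.cons_val_one]
      module
    have := congrArg Complex.ofRealHom.mapMatrix h
    rw [map_sum, map_one] at this
    exact this

/-- The tilt `α` of the Bell expression for the state `(i, k)` of the pair. -/
noncomputable def tiltAngle (i k : Fin 2) : ℝ := if i = k then 0 else 6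

/-- The weight `r` of the CHSH part of the Bell expression for the state `(i, k)`. -/
noncomputable def chshWeight (i k : Fin 2) : ℝ := if i = k then √50 else √41

theorem chshWeight_pos (i k : Fin 2) : 0 < chshWeight i k := by
  unfold chshWeight; split_ifs <;> positivity

/-- 50 and 41 solve 2α² + 8r² = 400 for α = 0 and α = 6. For i = k the state is maximally entangled
on two levels, and plain CHSH is optimal. For i ≠ k the Schmidt ratio 2 : 1 means sin 2θ = 4/5, and
the relative tilt α/r = 6/√41 is the optimal 2/√(1 + 2 tan² 2θ). -/
theorem chshWeight_sq (i k : Fin 2) : chshWeight i k ^ 2 = if i = k then 50 else 41 := by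
  unfold chshWeight; split_ifs <;> exact Real.sq_sqrt (by norm_num)

/-- The observables of the left party. -/
def leftObs (i x : Fin 2) : Matrix (Fin 3) (Fin 3) ℝ :=
  levelObs i.castSucc 2 ((![1, 0] : Fin 2 → ℝ) x) ((![0, 1] : Fin 2 → ℝ) x)

/-- The observables of the right party. -/
noncomputable def rightObs (i k y : Fin 2) : Matrix (Fin 3) (Fin 3) ℝ :=
  levelObs (if i = k then 2 else k.castSucc) (if i = k then k.castSucc else 2)
    (5 / chshWeight i k) (outcomeSign y * (if i = k then -5 else -4) / chshWeight i k)

theorem isPOVM_leftObs (i x : Fin 2) :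
    IsPOVM fun a => (obsEffect (leftObs i x) a).map (Complex.ofReal : ℝ → ℂ) :=
  isPOVM_obsEffect (levelObs_transpose _ _ _ _)
    (levelObs_mul_self (by fin_cases i <;> decide) (by fin_cases x <;> simp))

/-- The measurement directions have slope sin 2θ, which is 1 or 4/5; hence 25 + 25 = 50 and 25 + 16
= 41 match the squared weights. The minus signs reflect the opposite signs of the two amplitudes of
the pair. -/
theorem isPOVM_rightObs (i k y : Fin 2) :
    IsPOVM fun a => (obsEffect (rightObs i k y) a).map (Complex.ofReal : ℝ → ℂ) := by
  refine isPOVM_obsEffect (levelObs_transpose _ _ _ _) (levelObs_mul_self ?_ ?_)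
  · fin_cases i <;> fin_cases k <;> decide
  · rw [div_pow, div_pow, mul_pow, chshWeight_sq, ← add_div, div_eq_one_iff_eq]
    · split_ifs <;> fin_cases y <;> norm_num [outcomeSign]
    · split_ifs <;> norm_num

theorem sum_tiltedCoeff_obsEffect (α r : ℝ) (A B : Fin 2 → Matrix (Fin 3) (Fin 3) ℝ)
    (p q : Fin 3 × Fin 3) :
    ∑ x, ∑ y, ∑ a, ∑ b, tiltedCoeff α r x y a b *
      (obsEffect (A x) a p.1 q.1 * obsEffect (B y) b p.2 q.2) =
    A 0 p.1 q.1 * (α * (if p.2 = q.2 then 1 else 0) +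
        r * (B 0 p.2 q.2 + B 1 p.2 q.2)) +
      A 1 p.1 q.1 * (r * (B 0 p.2 q.2 - B 1 p.2 q.2)) := by
  rw [← Matrix.one_apply]
  simp [Fin.sum_univ_two, tiltedCoeff, outcomeSign, obsEffect]
  ring

/-- The state of the pair is an eigenvector of the Bell operator. -/
theorem bell_eigenvector (i k : Fin 2) (p : Fin 3 × Fin 3) :
    ∑ q : Fin 3 × Fin 3, (∑ x, ∑ y, ∑ a, ∑ b, tiltedCoeff (tiltAngle i k) (chshWeight i k) x y a b *
      (obsEffect (leftObs i x) a p.1 q.1 * obsEffect (rightObs i k y) b p.2 q.2)) *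
        pairAmp i k q = 20 * pairAmp i k p := by
  have hr := (chshWeight_pos i k).ne'
  have h2 := inv_sqrt_two_mul_self
  rw [Finset.sum_congr rfl fun q _ => by rw [sum_tiltedCoeff_obsEffect]]
  obtain ⟨p₁, p₂⟩ := p
  simp only [leftObs, rightObs, tiltAngle, Fintype.sum_prod_type]
  -- Only r ≠ 0 matters: on the levels that carry the state, r(B₀ + B₁) is 10 Z and r(B₀ - B₁) is
  -- -10 X or -8 X.
  generalize chshWeight i k = r at hr
  fin_cases i <;> fin_cases k <;> fin_cases p₁ <;> fin_cases p₂ <;>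
    simp [levelObs, pairAmp, mpsMat, Matrix.mul_apply, Fin.sum_univ_three, outcomeSign, h2] <;>
    field_simp <;> first | ring1 | simp

end Observables

/-! ### The scheme for the AKLT state -/

section Scheme

variable {N n : ℕ}

open Classical in
/-- The coefficients of the Bell expression for the AKLT state. -/
noncomputable def akltCoeff (τ : (j : ZMod N) → Branch j n → Fin 2 × Fin 2) : BellCoeff N n :=
  fun j μ => if IsCut μ then
    tiltedCoeff (tiltAngle (τ j μ).1 (τ j μ).2) (chshWeight (τ j μ).1 (τ j μ).2) else 0

/-- The local bound of the Bell expressions. -/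
noncomputable def localBound : ℝ := 6 + 2 * √41

theorem localBound_nonneg : 0 ≤ localBound := by unfold localBound; positivity

/-- This makes the relative gap explicit: 1 - (96/5)/20 = 1/25. -/
theorem localBound_le : localBound ≤ 96 / 5 := by
  have : √41 ≤ 33 / 5 := Real.sqrt_le_iff.mpr ⟨by norm_num, by norm_num⟩
  unfold localBound
  linarith

/-- The tilted expression attains the common local bound; plain CHSH has 2√50, which is smaller
since √50 ≤ 3 + √41. -/
theorem isTiltedOrZero_akltCoeff (τ : (j : ZMod N) → Branch j n → Fin 2 × Fin 2) (j : ZMod N)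
    (μ : Branch j n) : IsTiltedOrZero localBound (akltCoeff τ j μ) := by
  unfold akltCoeff
  split_ifs
  · right
    refine ⟨_, _, ?_, (chshWeight_pos _ _).le, ?_, ?_, rfl⟩
    · unfold tiltAngle; split_ifs <;> norm_num
    · rw [chshWeight_sq]; unfold tiltAngle; split_ifs <;> norm_num
    · unfold tiltAngle chshWeight localBound
      split_ifs
      · have h41 := Real.sq_sqrt (show (0 : ℝ) ≤ 41 by norm_num)
        have : √50 ≤ 3 + √41 := Real.sqrt_le_iff.mpr ⟨by positivity, by
          nlinarith [Real.sqrt_nonneg 41]⟩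
        linarith
      · exact le_rfl
  · exact Or.inl rfl

variable [NeZero N]

theorem isPOVM_single : IsPOVM fun o : Fin 3 => Matrix.single o o (1 : ℂ) := by
  constructor
  · intro o
    have : Matrix.single o o (1 : ℂ) =
        (Matrix.single o o (1 : ℂ)).conjTranspose * Matrix.single o o (1 : ℂ) := by
      rw [Matrix.conjTranspose_single, star_one, Matrix.single_mul_single_same, mul_one]
    change (Matrix.single o o (1 : ℂ)).PosSemidef
    rw [this]
    exact Matrix.posSemidef_conjTranspose_mul_self _
  · ext a b
    simp [Matrix.sum_apply, Matrix.single_apply, Matrix.one_apply, ite_and]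

/-- The devices for the AKLT state: in the branch `μ` of the pair `(j, j + 1)`, the parties of the
pair perform the optimal measurements for the state `τ j μ`. -/
noncomputable def akltDevices (τ : (j : ZMod N) → Branch j n → Fin 2 × Fin 2) :
    Devices N n (fun _ => 3) where
  cut _ o := Matrix.single o o 1
  bell i j μ x a := if i = j then (obsEffect (leftObs (τ j μ).1 x) a).map Complex.ofReal
    else (obsEffect (rightObs (τ j μ).1 (τ j μ).2 x) a).map Complex.ofReal
  cut_povm _ := isPOVM_single
  bell_povm i j μ x := by
    by_cases h : i = j
    · simpa only [h, if_true] using isPOVM_leftObs (τ j μ).1 x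
    · simpa only [h, if_false] using isPOVM_rightObs (τ j μ).1 (τ j μ).2 x

open Classical in
-- Cutting in the basis is diagonal: it restricts the amplitudes to the compatible configurations.
theorem piOp_cutLocal_of_cutsInBasis {D : Devices N n (fun _ => 3)} (hD : CutsInBasis D)
    {j : ZMod N} (μ : Branch j n) :
    piOp (cutLocal D μ) = Matrix.diagonal fun s => if Matches μ s then (1 : ℂ) else 0 := by
  have hC : ∀ i a b, cutLocal D μ i a b =
      if a = b ∧ ∀ h : i ∈ leftBlock j n ∪ rightBlock j n, a = μ ⟨i, h⟩ then 1 else 0 := by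
    intro i a b
    by_cases h : i ∈ leftBlock j n ∪ rightBlock j n
    · rw [cutLocal, dif_pos h, hD, Matrix.single_apply]
      refine if_congr ?_ rfl rfl
      constructor
      · rintro ⟨rfl, rfl⟩; exact ⟨rfl, fun _ => rfl⟩
      · rintro ⟨rfl, h'⟩; exact ⟨(h' h).symm, (h' h).symm⟩
    · rw [cutLocal_of_notMem D μ h, Matrix.one_apply]
      exact if_congr (by simp [h]) rfl rfl
  ext s t
  rw [piOp, Matrix.of_apply]
  simp only [hC]
  by_cases hst : s = t
  · subst hst
    rw [Matrix.diagonal_apply_eq]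
    split_ifs with h
    · exact Finset.prod_eq_one fun i _ => if_pos ⟨rfl, fun hi => h ⟨i, hi⟩⟩
    · obtain ⟨i, hi⟩ := not_forall.mp h
      exact Finset.prod_eq_zero (Finset.mem_univ i.1) (if_neg fun h => hi (h.2 i.2))
  · rw [Matrix.diagonal_apply_ne _ hst]
    obtain ⟨i, hi⟩ := Function.ne_iff.mp hst
    exact Finset.prod_eq_zero (Finset.mem_univ i) (if_neg fun h => hi h.1)

open Classical in
/-- The joint probabilities of the AKLT state in a branch in which the state factorizes. -/
theorem jointProb_akltDensity (hN : 2 * n + 2 ≤ N) {D : Devices N n (fun _ => 3)}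
    (hD : CutsInBasis D) {j : ZMod N} {μ : Branch j n} {i k : Fin 2}
    {f : (ZMod N → Fin 3) → ℝ} (hf : ∀ s q, f (pairUpdate j s q) = f s)
    (h : ∀ s, Matches μ s → akltState N s = ((f s * pairAmp i k (s j, s (j + 1)) : ℝ) : ℂ))
    {x y a b : Fin 2} {E F : Matrix (Fin 3) (Fin 3) ℝ}
    (hE : D.bell j j μ x a = E.map Complex.ofReal)
    (hF : D.bell (j + 1) j μ y b = F.map Complex.ofReal) :
    jointProb D (akltDensity N) j μ x y a b = ∑ s, if Matches μ s then
      f s ^ 2 * pairAmp i k (s j, s (j + 1)) *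
        ∑ q : Fin 3 × Fin 3, E (s j) q.1 * F (s (j + 1)) q.2 * pairAmp i k q else 0 := by
  have hj := self_ne_add_one (N := N) (by omega) j
  rw [jointProb_eq hN, piOp_cutLocal_of_cutsInBasis hD, akltDensity, Matrix.vecMulVec_mul,
    Matrix.trace_vecMulVec, dotProduct_comm, ← Matrix.dotProduct_mulVec, ← Matrix.mulVec_mulVec,
    siteHom_mul_siteHom_mulVec hj, hE, hF, dotProduct, Complex.re_sum]
  refine Finset.sum_congr rfl fun s _ => ?_
  simp only [localAction, Matrix.mulVec_diagonal, matches_pairUpdate hN, Matrix.of_apply,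
    Matrix.map_apply, Pi.star_apply]
  split_ifs with hs
  · rw [h s hs]
    have : ∀ q, akltState N (pairUpdate j s q) = ((f s * pairAmp i k q : ℝ) : ℂ) := fun q => by
      rw [h _ ((matches_pairUpdate hN μ s q).mpr hs), hf, pairUpdate_left s q hj,
        pairUpdate_right]
    simp only [this, one_mul, Complex.star_def, Complex.conj_ofReal, ← Complex.ofReal_mul,
      ← Complex.ofReal_sum, Complex.ofReal_re, Finset.mul_sum]
    exact Finset.sum_congr rfl fun q _ => by ring
  · simp

/-- The Bell expression of a branch in which the pair is cut out attains its maximum. -/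
theorem branchValue_akltState (hN : 2 * n + 2 ≤ N)
    {τ : (j : ZMod N) → Branch j n → Fin 2 × Fin 2} {j : ZMod N} {μ : Branch j n}
    (hμ : Factorizes μ (τ j μ).1 (τ j μ).2) :
    ∑ x, ∑ y, ∑ a, ∑ b,
      tiltedCoeff (tiltAngle (τ j μ).1 (τ j μ).2) (chshWeight (τ j μ).1 (τ j μ).2) x y a b *
        jointProb (akltDevices τ) (akltDensity N) j μ x y a b =
      20 * branchProb (akltState N) μ := by
  classical
  obtain ⟨f, hf, h⟩ := hμ
  have hj := self_ne_add_one (N := N) (by omega) j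
  have hjoint := fun x y a b => jointProb_akltDensity hN (D := akltDevices τ) (fun _ _ => rfl) hf h
    (x := x) (y := y) (a := a) (b := b) (E := obsEffect (leftObs (τ j μ).1 x) a)
    (F := obsEffect (rightObs (τ j μ).1 (τ j μ).2 y) b) (if_pos rfl) (if_neg hj.symm)
  generalize (τ j μ).1 = i, (τ j μ).2 = k at *
  simp only [hjoint, Finset.mul_sum]
  have hcomm : ∀ g : Fin 2 → Fin 2 → Fin 2 → Fin 2 → (ZMod N → Fin 3) → ℝ,
      ∑ x, ∑ y, ∑ a, ∑ b, ∑ s, g x y a b s = ∑ s, ∑ x, ∑ y, ∑ a, ∑ b, g x y a b s := fun g => by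
    simp only [Finset.sum_comm (s := (Finset.univ : Finset (Fin 2)))
      (t := (Finset.univ : Finset (ZMod N → Fin 3)))]
  rw [hcomm, branchProb_eq, Finset.mul_sum]
  refine Finset.sum_congr rfl fun s _ => ?_
  split_ifs with hs
  -- The Bell operator of this branch acts on the pair factor as the number 20.
  · have he := bell_eigenvector i k (s j, s (j + 1))
    rw [h s hs, Complex.norm_real, Real.norm_eq_abs, sq_abs]
    calc _ = f s ^ 2 * pairAmp i k (s j, s (j + 1)) * ∑ q : Fin 3 × Fin 3,
          (∑ x, ∑ y, ∑ a, ∑ b, tiltedCoeff (tiltAngle i k) (chshWeight i k) x y a b *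
            (obsEffect (leftObs i x) a (s j) q.1 * obsEffect (rightObs i k y) b (s (j + 1)) q.2)) *
              pairAmp i k q := by
          simp only [Fin.sum_univ_two, Finset.mul_sum, ← Finset.sum_add_distrib]
          exact Finset.sum_congr rfl fun q _ => by ring
      _ = _ := by rw [he]; ring
  · simp

/-- In a cut branch the expression tuned to the resulting state reaches 20 times the branch
probability, and in all other branches the coefficients are zero. -/
theorem exists_scheme (hN : 2 * n + 2 ≤ N) :
    ∃ (c : BellCoeff N n) (D : Devices N n (fun _ => 3)), CutsInBasis D ∧
      (∀ j μ, IsTiltedOrZero localBound (c j μ)) ∧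
      ∀ j, pairValue c D (akltDensity N) j = 20 * cutProb (akltState N) j n := by
  classical
  have hτ : ∀ (j : ZMod N) (μ : Branch j n), ∃ t : Fin 2 × Fin 2,
      IsCut μ → Factorizes μ t.1 t.2 := by
    intro j μ
    by_cases hμ : IsCut μ
    · obtain ⟨i, k, h⟩ := hμ.factorizes hN
      exact ⟨(i, k), fun _ => h⟩
    -- An arbitrary label: the coefficients vanish in this branch.
    · exact ⟨(0, 0), fun h => absurd h hμ⟩
  choose τ hτ using hτ
  refine ⟨akltCoeff τ, akltDevices τ, fun _ _ => rfl, isTiltedOrZero_akltCoeff τ, fun j => ?_⟩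
  rw [pairValue, cutProb, Finset.mul_sum]
  refine Finset.sum_congr rfl fun μ _ => ?_
  unfold akltCoeff
  split_ifs with hμ
  · exact branchValue_akltState hN (hτ j μ hμ)
  · simp

/-- The AKLT value is at least 20N - 40N · 3⁻ⁿ and the biseparable bound is 20N - (20 -
`localBound`). Half of `3 ^ n` would be the break-even point for `N`; the quarter gives the strict
inequality. -/
theorem detectsGME_of_le (hn : 1 ≤ n) (hN : 2 * n + 2 ≤ N)
    (h : (N : ℝ) ≤ 3 ^ n / 4 * (1 - localBound / 20)) : DetectsGME N n := by
  obtain ⟨c, D, hD, hc, hv⟩ := exists_scheme (N := N) hN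
  refine ⟨c, D, (N - 1) * 20 + localBound, hD,
    fun d D' ρ hρ => bellValue_le_of_biseparable hN localBound_nonneg hc D' hρ, ?_⟩
  have hlow : (N : ℝ) * (20 * (1 - 2 * (1 / 3 : ℝ) ^ n)) ≤ bellValue c D (akltDensity N) := by
    rw [bellValue]
    have := Finset.card_nsmul_le_sum (Finset.univ : Finset (ZMod N))
      (fun j => pairValue c D (akltDensity N) j) (20 * (1 - 2 * (1 / 3 : ℝ) ^ n)) fun j _ => by
        rw [hv]
        exact mul_le_mul_of_nonneg_left (cutProb_bounds hn hN j).1 (by norm_num)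
    rwa [Finset.card_univ, ZMod.card, nsmul_eq_mul] at this
  refine lt_of_lt_of_le ?_ hlow
  have h3 : (1 / 3 : ℝ) ^ n * 3 ^ n = 1 := by rw [← mul_pow]; norm_num
  have hpos : (0 : ℝ) < (1 / 3) ^ n := by positivity
  have hN0 : (0 : ℝ) < N := by exact_mod_cast NeZero.pos N
  have h4 := mul_le_mul_of_nonneg_right h hpos.le
  have h5 : 3 ^ n / 4 * (1 - localBound / 20) * (1 / 3 : ℝ) ^ n = (1 - localBound / 20) / 4 := by
    linear_combination (1 - localBound / 20) / 4 * h3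
  rw [h5] at h4
  nlinarith [mul_pos hN0 hpos]

/-! ### The choice of `n` logarithmic in `N` -/

theorem three_mul_sq_lt_three_pow {n : ℕ} (hn : 6 ≤ n) : 3 * (2 * n + 1) ^ 2 < 3 ^ n := by
  induction n, hn using Nat.le_induction with
  | base => norm_num
  | succ n hn ih =>
    calc 3 * (2 * (n + 1) + 1) ^ 2 ≤ 3 * (2 * n + 1) ^ 2 * 3 := by nlinarith
      _ < 3 ^ n * 3 := by omega
      _ = 3 ^ (n + 1) := (pow_succ 3 n).symm

/-- The power of 3 with exponent 2 log₃ N is N², and rounding the exponent up costs at most a factor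
3. -/
theorem sq_le_three_pow_ceil {N n : ℕ} (hN : 1 ≤ N) (hn : n = ⌈2 * Real.logb 3 N⌉₊) :
    N ^ 2 ≤ 3 ^ n ∧ 3 ^ n ≤ 3 * N ^ 2 := by
  have hN1 : (1 : ℝ) ≤ N := by exact_mod_cast hN
  have hpow : (3 : ℝ) ^ (2 * Real.logb 3 N) = (N : ℝ) ^ 2 := by
    rw [mul_comm, Real.rpow_mul (by norm_num), Real.rpow_logb (by norm_num) (by norm_num)
      (by linarith)]
    exact_mod_cast Real.rpow_natCast (N : ℝ) 2
  have hlog : 0 ≤ 2 * Real.logb 3 N :=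
    mul_nonneg (by norm_num) (Real.logb_nonneg (by norm_num) hN1)
  have h1 : 2 * Real.logb 3 N ≤ (n : ℝ) := hn ▸ Nat.le_ceil _
  have h2 : (n : ℝ) ≤ 2 * Real.logb 3 N + 1 := hn ▸ (Nat.ceil_lt_add_one hlog).le
  constructor
  · have := Real.rpow_le_rpow_of_exponent_le (show (1 : ℝ) ≤ 3 by norm_num) h1
    rw [hpow, Real.rpow_natCast] at this
    exact_mod_cast this
  · have := Real.rpow_le_rpow_of_exponent_le (show (1 : ℝ) ≤ 3 by norm_num) h2
    rw [Real.rpow_add (by norm_num), hpow, Real.rpow_natCast, Real.rpow_one, mul_comm] at this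
    exact_mod_cast this

end Scheme

theorem mainTheorem6 :
    -- the AKLT state is a ground state; each site measurement has uniformly random outcomes
    (∀ (N : ℕ) [NeZero N], 3 ≤ N →
      IsGroundState (akltHamiltonian N) (akltState N) ∧
      ∀ (i : ZMod N) (o : Fin 3),
        (∑ s : ZMod N → Fin 3, if s i = o then ‖akltState N s‖ ^ 2 else 0) = 1 / 3) ∧
    -- cutting out a pair: number of branches, success probability, resulting states
    (∀ (N : ℕ) [NeZero N] (n : ℕ), 1 ≤ n → 2 * n + 2 ≤ N → ∀ j : ZMod N,
      Fintype.card (Branch j n) = 3 ^ (2 * n) ∧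
      1 - 2 * (1 / 3 : ℝ) ^ n ≤ cutProb (akltState N) j n ∧
      cutProb (akltState N) j n ≤ 1 - 2 * (1 / 3 : ℝ) ^ n + 2 * (1 / 9 : ℝ) ^ n ∧
      ∀ μ : Branch j n, IsCut μ → branchProb (akltState N) μ ≠ 0 →
        ∃ i k : Fin 2, IsEntangled (pairVec i k) ∧
          pairState (akltState N) μ =
            Matrix.vecMulVec (pairVec i k) (star (pairVec i k : Fin 3 × Fin 3 → ℂ))) ∧
    -- device-independent detection of genuine multipartite entanglement
    (∃ βL βs : ℝ, 0 ≤ βL ∧ βL < βs ∧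
      ∀ (N : ℕ) [NeZero N] (n : ℕ), 1 ≤ n → 2 * n + 2 ≤ N →
        (∃ (c : BellCoeff N n) (D : Devices N n (fun _ => 3)), CutsInBasis D ∧
          (∀ j, βs * (1 - 4 * (1 / 3 : ℝ) ^ n) ≤ pairValue c D (akltDensity N) j) ∧
          (∀ (d : ZMod N → ℕ) (D' : Devices N n d)
            (ρ : Matrix ((i : ZMod N) → Fin (d i)) ((i : ZMod N) → Fin (d i)) ℂ),
            (IsDensity ρ → ∀ j, pairValue c D' ρ j ≤ βs) ∧
            (IsBiseparable ρ → bellValue c D' ρ ≤ (N - 1) * βs + βL))) ∧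
        ((N : ℝ) ≤ 3 ^ n / 4 * (1 - βL / βs) → DetectsGME N n)) ∧
    -- `n = 2 log₃ N`: polynomially many branches suffice for all large `N`
    (∃ N₀ : ℕ, ∀ (N : ℕ) [NeZero N], N₀ ≤ N → ∀ n : ℕ, n = ⌈2 * Real.logb 3 N⌉₊ →
      2 * n + 2 ≤ N ∧
      (∀ j : ZMod N, Fintype.card (Branch j n) = 3 ^ (2 * n) ∧
        1 - 2 / (N : ℝ) ^ 2 ≤ cutProb (akltState N) j n) ∧
      N ^ 4 ≤ 3 ^ (2 * n) ∧ 3 ^ (2 * n) ≤ 9 * N ^ 4 ∧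
      DetectsGME N n) := by
  refine ⟨fun N _ hN => ⟨isGroundState_akltState (by omega), prob_site (by omega)⟩,
    fun N _ n hn hN j => ⟨card_branch hN j, (cutProb_bounds hn hN j).1, (cutProb_bounds hn hN j).2,
      fun μ hμ h0 => ?_⟩, ?_, ?_⟩
  · obtain ⟨i, k, h⟩ := hμ.factorizes hN
    exact ⟨i, k, isEntangled_pairVec i k, h.pairState_eq hN h0⟩
  · refine ⟨localBound, 20, localBound_nonneg, by linarith [localBound_le],
      fun N _ n hn hN => ⟨?_, detectsGME_of_le hn hN⟩⟩
    obtain ⟨c, D, hD, hc, hv⟩ := exists_scheme (N := N) hN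
    refine ⟨c, D, hD, fun j => ?_, fun d D' ρ => ⟨fun hρ => pairValue_le hN hc D' hρ,
      fun hρ => bellValue_le_of_biseparable hN localBound_nonneg hc D' hρ⟩⟩
    have h := (cutProb_bounds hn hN j).1
    have hpos : (0 : ℝ) < (1 / 3) ^ n := by positivity
    rw [hv]
    linarith
  -- 100 = 4 · 25: with 3ⁿ ≥ N² and the relative gap 1/25, the condition for detection follows from
  -- N ≤ N²/100.
  · refine ⟨100, fun N _ hN n hn => ?_⟩
    obtain ⟨hlow, hhigh⟩ := sq_le_three_pow_ceil (by omega) hn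
    have hnN : 2 * n + 2 ≤ N := by
      by_contra! h
      -- If the window did not fit, then N ≤ 2n + 1, and 3ⁿ ≤ 3N² would contradict exponential
      -- growth; N ≥ 100 makes `n` large enough for this.
      have h1 := three_mul_sq_lt_three_pow (n := n) (by omega)
      have h2 : N ^ 2 ≤ (2 * n + 1) ^ 2 := Nat.pow_le_pow_left (by omega) 2
      omega
    have hn1 : 1 ≤ n := by
      by_contra! h
      have : n = 0 := by omega
      subst this
      nlinarith
    have hlow' : (N : ℝ) ^ 2 ≤ 3 ^ n := by exact_mod_cast hlow
    have hN' : (100 : ℝ) ≤ N := by exact_mod_cast hN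
    refine ⟨hnN, fun j => ⟨card_branch hnN j, le_trans ?_ (cutProb_bounds hn1 hnN j).1⟩, ?_, ?_,
      detectsGME_of_le hn1 hnN ?_⟩
    · have : (1 / 3 : ℝ) ^ n ≤ 1 / (N : ℝ) ^ 2 := by
        rw [div_pow, one_pow]
        exact one_div_le_one_div_of_le (by positivity) hlow'
      have h2 : 2 / (N : ℝ) ^ 2 = 2 * (1 / (N : ℝ) ^ 2) := by ring
      linarith
    · calc N ^ 4 = (N ^ 2) ^ 2 := by ring
        _ ≤ (3 ^ n) ^ 2 := Nat.pow_le_pow_left hlow 2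
        _ = 3 ^ (2 * n) := by ring
    · calc 3 ^ (2 * n) = (3 ^ n) ^ 2 := by ring
        _ ≤ (3 * N ^ 2) ^ 2 := Nat.pow_le_pow_left hhigh 2
        _ = 9 * N ^ 4 := by ring
    · have := localBound_le
      have h25 : (1 : ℝ) / 25 ≤ 1 - localBound / 20 := by linarith
      calc (N : ℝ) ≤ (N : ℝ) ^ 2 / 4 * (1 / 25) := by nlinarith
        _ ≤ 3 ^ n / 4 * (1 - localBound / 20) := by gcongr
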